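/- **Theorem 5.1.** Let $p,n,\alpha$ be real numbers with $p>1$ and $\alpha>-1$, put $\varphi(v)=v|v|^{p-2}$, and consider for $\lambda>0$ the problem $$\varphi(u')'+\frac{n-1}{r}\,\varphi(u')+\lambda\, r^{\alpha}e^{u}=0\quad (0<r<1),\qquad u'(0)=0,\quad u(1)=0, \tag{1}$$ where a solution is a function $u\in C^1[0,1]$ such that $\varphi(u')$ is differentiable on $(0,1)$ and (1) holds. Assume that $$p<n<\frac{p^2+3p+4\alpha}{p-1}.$$ Then every solution $u$ of (1) with $\lambda>0$ has $u(0)>0$; for every $a>0$ there is exactly one pair $(\lambda,u)=(\Lambda(a),u_a)$ with $\lambda>0$ such that $u$ solves (1) and $u(0)=a$; and $\Lambda(a)$ and $u_a(r)$ depend continuously on $a>0$ and on $(a,r)\in(0,\infty)\times[0,1]$ respectively. The set of all solutions is thus described by the solution curve $\{(\Lambda(a),a):a>0\}$ in the $(\lambda,u(0))$ plane, and the following holds. 1. The solution curve makes infinitely many turns: there are infinitely many $a>0$ at which $\Lambda$ changes its direction of monotonicity, i.e. for some $0<b<a<c$ it is strictly increasing on $[b,a]$ and strictly decreasing on $[a,c]$,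 or vice versa. 2. Along the curve, as $a=u(0)\to\infty$, one has $\Lambda(a)\to\lambda_0:=(n-p)(p+\alpha)^{p-1}$, and $u_a(r)\to-(p+\alpha)\ln r$ for every $r\in(0,1]$. 3. The limit $u_0(r)=-(p+\alpha)\ln r$ is a singular solution of the equation in (1) with $\lambda=\lambda_0$: it satisfies the equation for $0<r<1$, $u_0(1)=0$, and $u_0(r)\to\infty$ as $r\to0^+$. -/

import Mathlib

open Set Filter Topology

namespace Gelfand

/-- The function `φ(v) = v |v|^(p-2)` of the one-dimensional `p`-Laplacian. -/
noncomputable def phi (p v : ℝ) : ℝ := v * |v| ^ (p - 2)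

/-- `u` is a classical solution on `0 < r < 1` of the radial equation
`φ(u')' + (n-1)/r φ(u') + lam r^α e^u = 0`; no condition is imposed at `r = 0` and `r = 1`. -/
def SolvesEquation (p n α lam : ℝ) (u : ℝ → ℝ) : Prop :=
  ∀ r ∈ Ioo (0 : ℝ) 1,
    DifferentiableAt ℝ u r ∧
    DifferentiableAt ℝ (fun s => phi p (deriv u s)) r ∧
    deriv (fun s => phi p (deriv u s)) r + (n - 1) / r * phi p (deriv u r)
      + lam * r ^ α * Real.exp (u r) = 0

/-- `u` is a (classical, `C¹` up to the boundary) solution of the boundary value problem: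
the equation on `(0,1)` together with `u'(0) = 0` and `u(1) = 0`. -/
structure IsSolution (p n α lam : ℝ) (u : ℝ → ℝ) : Prop where
  contDiffOn : ContDiffOn ℝ 1 u (Icc 0 1)
  equation : SolvesEquation p n α lam u
  deriv_zero : derivWithin u (Icc 0 1) 0 = 0
  boundary : u 1 = 0

/-- The pair `a ↦ (Λ a, U a)`, for `a > 0`, is the solution curve of the problem, with
`a = u(0)` as global parameter: it is a continuous curve of solution pairs with positive
parameter `lam`, and it exhausts all such solution pairs (functions being compared on `[0,1]`). -/
structure IsSolutionCurve (p n α : ℝ) (Λ : ℝ → ℝ) (U : ℝ → ℝ → ℝ) : Prop where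
  pos : ∀ a, 0 < a → 0 < Λ a
  solution : ∀ a, 0 < a → IsSolution p n α (Λ a) (U a)
  value_zero : ∀ a, 0 < a → U a 0 = a
  exhausts : ∀ (lam : ℝ) (u : ℝ → ℝ), 0 < lam → IsSolution p n α lam u →
    0 < u 0 ∧ lam = Λ (u 0) ∧ EqOn u (U (u 0)) (Icc 0 1)
  continuous_param : ContinuousOn Λ (Ioi 0)
  continuous_sol : ContinuousOn (fun q : ℝ × ℝ => U q.1 q.2) (Ioi 0 ×ˢ Icc 0 1)

/-- The curve `{(Λ a, a) : a > 0}` in the `(lam, u(0))` plane makes a turn at `a`: the function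
`Λ` changes there its direction of monotonicity. -/
def IsTurn (Λ : ℝ → ℝ) (a : ℝ) : Prop :=
  ∃ b c : ℝ, 0 < b ∧ b < a ∧ a < c ∧
    ((StrictMonoOn Λ (Icc b a) ∧ StrictAntiOn Λ (Icc a c)) ∨
     (StrictAntiOn Λ (Icc b a) ∧ StrictMonoOn Λ (Icc a c)))

/-- A singular solution of the equation: it solves it on `0 < r < 1`, vanishes at `r = 1`, and
tends to infinity as `r → 0`. -/
structure IsSingularSolution (p n α lam : ℝ) (u : ℝ → ℝ) : Prop where
  equation : SolvesEquation p n α lam u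
  boundary : u 1 = 0
  singular : Tendsto u (𝓝[>] 0) atTop

end Gelfand

namespace Gelfand

/-! The theorem rests on a scaling invariance. Let `w` solve the equation with parameter 1 on the
half-line, with `w(0) = w'(0) = 0`. Then `a + w(ρ r)` solves it with parameter `ρ^(p+α) e^(-a)`, and
it vanishes at `r = 1` exactly when `w(ρ) = -a`. Every solution has this form, and `w` decreases
strictly to `-∞`, so `ρ` is a function of `a` and the whole curve is read off from the single
function `w`: `log Λ = w(ρ) + (p+α) log ρ`.

Put `β = p+α`, `N = n-p`, `m = 1/(p-1)`. In the variable `t = log r`, the normalised quantities `Y =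
w + βt - const` and `Q` (the flux `|w'|^(p-1)` times a power of `r`) satisfy the autonomous system
`Y' = β(1 - Q^m)`, `Q' = N(e^Y - Q)`. Its equilibrium `(0,1)` is the singular solution. Thus `Λ →
λ₀` amounts to `Y → 0`, and the turns of `Λ` are those of `Y`.

A Lyapunov function and Barbalat's lemma give convergence to the equilibrium
(`IsTrajectory.tendsto`). The linearisation there has characteristic polynomial `μ² + Nμ + Nβm`,
with non-real roots iff `N < 4βm`, which is precisely the upper bound on `n`. The orbit therefore
spirals: a Riccati inequality for `Y/(Q-1)` shows that `Q` returns to 1 at arbitrarily large times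
(`IsTrajectory.exists_eq_one`). Each return with `Y ≠ 0` is transversal, so `Y` turns there.

Existence and uniqueness of `w` come from Picard iteration for an integrated form of the equation
(`exists_radialOp_fixedPoint`, `radialOp_fixedPoint_unique`), in which averaging removes the
singularity at `r = 0`. -/

/-- The average of `exp ∘ w` over `[0, s]` with respect to the measure proportional to
`z ^ (ν - 1) dz`. -/
noncomputable def expAvg (ν : ℝ) (w : ℝ → ℝ) (s : ℝ) : ℝ :=
  ∫ τ in (0 : ℝ)..1, Real.exp (w (s * τ ^ (1 / ν)))

/-- The modulus of the slope at `s` of the image of `w` under the radial solution operator. -/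
noncomputable def radialSlope (ν γ m : ℝ) (w : ℝ → ℝ) (s : ℝ) : ℝ :=
  (max s 0) ^ γ * (expAvg ν w s / ν) ^ m

/-- The radial solution operator, whose fixed points solve the initial value problem. -/
noncomputable def radialOp (ν γ m : ℝ) (w : ℝ → ℝ) (r : ℝ) : ℝ :=
  -∫ s in (0 : ℝ)..r, radialSlope ν γ m w s

/-! ### The integral operator: Picard iteration for the initial value problem. -/

section Operator

variable {ν γ m : ℝ}

theorem continuous_expAvg_integrand (hν : 0 < ν) {w : ℝ → ℝ} (hw : Continuous w) :
    Continuous (Function.uncurry fun s τ : ℝ => Real.exp (w (s * τ ^ (1 / ν)))) := by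
  have h : Continuous fun τ : ℝ => τ ^ (1 / ν) := Real.continuous_rpow_const (by positivity)
  unfold Function.uncurry
  fun_prop

theorem continuous_expAvg_integrand_right (hν : 0 < ν) {w : ℝ → ℝ} (hw : Continuous w) (s : ℝ) :
    Continuous fun τ : ℝ => Real.exp (w (s * τ ^ (1 / ν))) := by
  have h : Continuous fun τ : ℝ => τ ^ (1 / ν) := Real.continuous_rpow_const (by positivity)
  fun_prop

theorem continuous_expAvg (hν : 0 < ν) {w : ℝ → ℝ} (hw : Continuous w) :
    Continuous (expAvg ν w) :=
  intervalIntegral.continuous_parametric_intervalIntegral_of_continuous'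
    (continuous_expAvg_integrand hν hw) 0 1

theorem mul_rpow_mem_Icc (hν : 0 < ν) {s τ : ℝ} (hs : 0 ≤ s) (hτ : τ ∈ Icc (0 : ℝ) 1) :
    s * τ ^ (1 / ν) ∈ Icc 0 s := by
  have h0 : 0 ≤ τ ^ (1 / ν) := Real.rpow_nonneg hτ.1 _
  have h1 : τ ^ (1 / ν) ≤ 1 := Real.rpow_le_one hτ.1 hτ.2 (by positivity)
  exact ⟨by positivity, by nlinarith⟩

theorem expAvg_pos (hν : 0 < ν) {w : ℝ → ℝ} (hw : Continuous w) (s : ℝ) : 0 < expAvg ν w s :=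
  intervalIntegral.intervalIntegral_pos_of_pos
    ((continuous_expAvg_integrand_right hν hw s).intervalIntegrable _ _)
    (fun _ => Real.exp_pos _) one_pos

theorem expAvg_le_one (hν : 0 < ν) {w : ℝ → ℝ} (hw : Continuous w) {s : ℝ} (hs : 0 ≤ s)
    (h : ∀ x ∈ Icc 0 s, w x ≤ 0) : expAvg ν w s ≤ 1 := by
  have := intervalIntegral.integral_mono_on (μ := MeasureTheory.volume) (zero_le_one' ℝ)
    ((continuous_expAvg_integrand_right hν hw s).intervalIntegrable _ _)
    (_root_.intervalIntegrable_const (c := (1 : ℝ)))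
    (fun τ hτ => Real.exp_le_one_iff.2 (h _ (mul_rpow_mem_Icc hν hs hτ)))
  simpa [expAvg] using this

theorem exp_neg_le_expAvg (hν : 0 < ν) {w : ℝ → ℝ} (hw : Continuous w) {s K : ℝ} (hs : 0 ≤ s)
    (h : ∀ x ∈ Icc 0 s, -K ≤ w x) : Real.exp (-K) ≤ expAvg ν w s := by
  have := intervalIntegral.integral_mono_on (μ := MeasureTheory.volume) (zero_le_one' ℝ)
    (_root_.intervalIntegrable_const (c := Real.exp (-K)))
    ((continuous_expAvg_integrand_right hν hw s).intervalIntegrable _ _)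
    (fun τ hτ => Real.exp_le_exp.2 (h _ (mul_rpow_mem_Icc hν hs hτ)))
  simpa [expAvg] using this

theorem abs_exp_sub_exp_le {a b : ℝ} (ha : a ≤ 0) (hb : b ≤ 0) :
    |Real.exp a - Real.exp b| ≤ |a - b| := by
  wlog hab : b ≤ a generalizing a b
  · rw [abs_sub_comm, abs_sub_comm a]
    exact this hb ha (le_of_not_ge hab)
  rw [abs_of_nonneg (sub_nonneg.2 (Real.exp_le_exp.2 hab)), abs_of_nonneg (sub_nonneg.2 hab)]
  have h1 : Real.exp b = Real.exp a * Real.exp (b - a) := by rw [← Real.exp_add]; ring_nf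
  have h2 := Real.add_one_le_exp (b - a)
  have h3 : Real.exp a ≤ 1 := Real.exp_le_one_iff.2 ha
  have h4 := Real.exp_pos a
  rw [h1]
  nlinarith

theorem abs_expAvg_sub_le (hν : 0 < ν) {w v : ℝ → ℝ} (hw : Continuous w) (hv : Continuous v)
    {s D : ℝ} {j : ℕ} (hD : 0 ≤ D) (hs : 0 ≤ s) (hw0 : ∀ x ∈ Icc 0 s, w x ≤ 0)
    (hv0 : ∀ x ∈ Icc 0 s, v x ≤ 0) (h : ∀ x ∈ Icc 0 s, |w x - v x| ≤ D * x ^ j) :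
    |expAvg ν w s - expAvg ν v s| ≤ D * s ^ j := by
  rw [expAvg, expAvg, ← intervalIntegral.integral_sub
    ((continuous_expAvg_integrand_right hν hw s).intervalIntegrable _ _)
    ((continuous_expAvg_integrand_right hν hv s).intervalIntegrable _ _), ← Real.norm_eq_abs]
  refine (intervalIntegral.norm_integral_le_of_norm_le_const (C := D * s ^ j)
    fun τ hτ => ?_).trans (by simp)
  rw [uIoc_of_le zero_le_one] at hτ
  have hx := mul_rpow_mem_Icc hν hs (Ioc_subset_Icc_self hτ)
  rw [Real.norm_eq_abs]
  refine (abs_exp_sub_exp_le (hw0 _ hx) (hv0 _ hx)).trans ((h _ hx).trans ?_)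
  have := pow_le_pow_left₀ hx.1 hx.2 j
  gcongr

theorem continuous_radialSlope (hν : 0 < ν) (hγ : 0 ≤ γ) (hm : 0 ≤ m) {w : ℝ → ℝ}
    (hw : Continuous w) : Continuous (radialSlope ν γ m w) := by
  have h1 := continuous_expAvg hν hw
  have h2 := Real.continuous_rpow_const hγ
  have h3 := Real.continuous_rpow_const hm
  unfold radialSlope
  fun_prop

theorem radialSlope_nonneg (hν : 0 < ν) {w : ℝ → ℝ} (hw : Continuous w) (s : ℝ) :
    0 ≤ radialSlope ν γ m w s :=
  mul_nonneg (Real.rpow_nonneg (le_max_right _ _) _)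
    (Real.rpow_nonneg (div_nonneg (expAvg_pos hν hw s).le hν.le) _)

theorem radialSlope_pos (hν : 0 < ν) {w : ℝ → ℝ} (hw : Continuous w) {s : ℝ} (hs : 0 < s) :
    0 < radialSlope ν γ m w s := by
  have := expAvg_pos hν hw s
  have : 0 < max s 0 := lt_max_of_lt_left hs
  unfold radialSlope
  positivity

theorem radialSlope_of_nonpos (hγ : 0 < γ) {w : ℝ → ℝ} {s : ℝ} (hs : s ≤ 0) :
    radialSlope ν γ m w s = 0 := by
  rw [radialSlope, max_eq_right hs, Real.zero_rpow hγ.ne', zero_mul]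

theorem hasDerivAt_radialOp (hν : 0 < ν) (hγ : 0 ≤ γ) (hm : 0 ≤ m) {w : ℝ → ℝ}
    (hw : Continuous w) (r : ℝ) :
    HasDerivAt (radialOp ν γ m w) (-radialSlope ν γ m w r) r :=
  ((continuous_radialSlope hν hγ hm hw).integral_hasStrictDerivAt 0 r).hasDerivAt.neg

theorem continuous_radialOp (hν : 0 < ν) (hγ : 0 ≤ γ) (hm : 0 ≤ m) {w : ℝ → ℝ}
    (hw : Continuous w) : Continuous (radialOp ν γ m w) :=
  continuous_iff_continuousAt.2 fun r => (hasDerivAt_radialOp hν hγ hm hw r).continuousAt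

theorem radialOp_nonpos (hν : 0 < ν) {w : ℝ → ℝ} (hw : Continuous w) {r : ℝ} (hr : 0 ≤ r) :
    radialOp ν γ m w r ≤ 0 :=
  neg_nonpos.2 (intervalIntegral.integral_nonneg hr fun s _ => radialSlope_nonneg hν hw s)

theorem radialOp_of_nonpos (hγ : 0 < γ) {w : ℝ → ℝ} {r : ℝ} (hr : r ≤ 0) :
    radialOp ν γ m w r = 0 := by
  rw [radialOp, neg_eq_zero, intervalIntegral.integral_symm, neg_eq_zero,
    intervalIntegral.integral_congr (g := fun _ => (0 : ℝ)), intervalIntegral.integral_zero]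
  intro s hs
  rw [uIcc_of_le hr] at hs
  exact radialSlope_of_nonpos hγ hs.2

theorem radialSlope_le (hν : 0 < ν) (hγ : 0 ≤ γ) (hm : 0 ≤ m) {w : ℝ → ℝ} (hw : Continuous w)
    {s R : ℝ} (hs : s ∈ Icc 0 R) (h : ∀ x ∈ Icc 0 R, w x ≤ 0) :
    radialSlope ν γ m w s ≤ R ^ γ * (1 / ν) ^ m := by
  have h1 := expAvg_le_one hν hw hs.1 fun x hx => h x ⟨hx.1, hx.2.trans hs.2⟩
  have h2 := (expAvg_pos hν hw s).le
  rw [radialSlope, max_eq_left hs.1]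
  have h3 := hs.1
  have h4 := hs.2
  have h5 : 0 ≤ R ^ γ := Real.rpow_nonneg (h3.trans h4) _
  gcongr

theorem neg_le_radialOp (hν : 0 < ν) (hγ : 0 ≤ γ) (hm : 0 ≤ m) {w : ℝ → ℝ} (hw : Continuous w)
    {r R : ℝ} (hr : r ∈ Icc 0 R) (h : ∀ x ∈ Icc 0 R, w x ≤ 0) :
    -(R ^ γ * (1 / ν) ^ m * R) ≤ radialOp ν γ m w r := by
  refine neg_le_neg ?_
  have hR : 0 ≤ R := hr.1.trans hr.2
  have := intervalIntegral.integral_mono_on (μ := MeasureTheory.volume) hr.1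
    ((continuous_radialSlope hν hγ hm hw).intervalIntegrable _ _)
    (_root_.intervalIntegrable_const (c := R ^ γ * (1 / ν) ^ m))
    (fun s hs => radialSlope_le hν hγ hm hw ⟨hs.1, hs.2.trans hr.2⟩ h)
  refine this.trans ?_
  rw [intervalIntegral.integral_const, smul_eq_mul, sub_zero, mul_comm]
  have := hr.2
  gcongr

/-- The power `x ^ m` need not be Lipschitz at 0, but the bound `-K ≤ w` keeps the averages in
`[e^(-K), 1]`, where it is. Carrying the weight `x ^ j` through the integral gains a factor `r /
(j+1)`, so iteration produces `1/j!` and no smallness of `R` is needed. -/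
theorem exists_radialOp_lipschitz (hν : 0 < ν) (hγ : 0 ≤ γ) (hm : 0 ≤ m) (K : ℝ) {R : ℝ}
    (hR : 0 ≤ R) :
    ∃ C : ℝ, 0 ≤ C ∧ ∀ w v : ℝ → ℝ, Continuous w → Continuous v →
      (∀ x ∈ Icc 0 R, w x ∈ Icc (-K) 0) → (∀ x ∈ Icc 0 R, v x ∈ Icc (-K) 0) →
      ∀ (D : ℝ) (j : ℕ), 0 ≤ D → (∀ x ∈ Icc 0 R, |w x - v x| ≤ D * x ^ j) →
      ∀ r ∈ Icc 0 R, |radialOp ν γ m w r - radialOp ν γ m v r|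
        ≤ C * D * (r ^ (j + 1) / (j + 1)) := by
  have hlip : ∃ L : NNReal, LipschitzOnWith L (fun x : ℝ => (x / ν) ^ m)
      (Icc (Real.exp (-K)) 1) := by
    refine ContDiffOn.exists_lipschitzOnWith (n := 1) ?_ one_ne_zero (convex_Icc _ _) isCompact_Icc
    refine ContDiffOn.rpow_const_of_ne (contDiffOn_id.div_const _) fun x hx => ?_
    have : 0 < x := (Real.exp_pos _).trans_le hx.1
    positivity
  obtain ⟨L, hL⟩ := hlip
  refine ⟨R ^ γ * L, by positivity, fun w v hw hv hwK hvK D j hD h r hr => ?_⟩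
  have key : ∀ s ∈ Icc 0 r, |radialSlope ν γ m w s - radialSlope ν γ m v s|
      ≤ R ^ γ * L * D * s ^ j := by
    intro s hs
    have hsub : ∀ x ∈ Icc 0 s, x ∈ Icc 0 R := fun x hx =>
      ⟨hx.1, hx.2.trans (hs.2.trans hr.2)⟩
    have h1 := abs_expAvg_sub_le hν hw hv hD hs.1 (fun x hx => (hwK x (hsub x hx)).2)
      (fun x hx => (hvK x (hsub x hx)).2) (fun x hx => h x (hsub x hx))
    have h2 := hL.dist_le_mul (expAvg ν w s)
      ⟨exp_neg_le_expAvg hν hw hs.1 fun x hx => (hwK x (hsub x hx)).1,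
        expAvg_le_one hν hw hs.1 fun x hx => (hwK x (hsub x hx)).2⟩ (expAvg ν v s)
      ⟨exp_neg_le_expAvg hν hv hs.1 fun x hx => (hvK x (hsub x hx)).1,
        expAvg_le_one hν hv hs.1 fun x hx => (hvK x (hsub x hx)).2⟩
    rw [Real.dist_eq, Real.dist_eq] at h2
    rw [radialSlope, radialSlope, max_eq_left hs.1, ← mul_sub, abs_mul,
      abs_of_nonneg (Real.rpow_nonneg hs.1 _)]
    have h3 : s ^ γ ≤ R ^ γ := Real.rpow_le_rpow hs.1 (hs.2.trans hr.2) hγ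
    calc _ ≤ R ^ γ * (L * (D * s ^ j)) := by gcongr; exact h2.trans (by gcongr)
      _ = _ := by ring
  have hc1 := continuous_radialSlope hν hγ hm hw
  have hc2 := continuous_radialSlope hν hγ hm hv
  rw [radialOp, radialOp, neg_sub_neg, abs_sub_comm, ← intervalIntegral.integral_sub
    (hc1.intervalIntegrable _ _) (hc2.intervalIntegrable _ _)]
  refine (intervalIntegral.abs_integral_le_integral_abs hr.1).trans ?_
  refine (intervalIntegral.integral_mono_on hr.1 ((hc1.sub hc2).abs.intervalIntegrable _ _)
    (Continuous.intervalIntegrable (by fun_prop) _ _) key).trans ?_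
  rw [intervalIntegral.integral_const_mul, integral_pow]
  simp

theorem radialOp_fixedPoint_unique (hν : 0 < ν) (hγ : 0 ≤ γ) (hm : 0 ≤ m) {w v : ℝ → ℝ}
    (hw : Continuous w) (hv : Continuous v) {R : ℝ} (hR : 0 ≤ R)
    (hwf : ∀ r ∈ Icc 0 R, w r = radialOp ν γ m w r)
    (hvf : ∀ r ∈ Icc 0 R, v r = radialOp ν γ m v r) : ∀ r ∈ Icc 0 R, w r = v r := by
  set K := R ^ γ * (1 / ν) ^ m * R
  have hK : 0 ≤ K := by positivity
  have bound : ∀ u : ℝ → ℝ, Continuous u → (∀ r ∈ Icc 0 R, u r = radialOp ν γ m u r) →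
      ∀ r ∈ Icc 0 R, u r ∈ Icc (-K) 0 := by
    intro u hu huf r hr
    have h0 : ∀ x ∈ Icc 0 R, u x ≤ 0 := fun x hx => by
      rw [huf x hx]; exact radialOp_nonpos hν hu hx.1
    exact ⟨by rw [huf r hr]; exact neg_le_radialOp hν hγ hm hu hr h0, h0 r hr⟩
  have hwK := bound w hw hwf
  have hvK := bound v hv hvf
  obtain ⟨C, hC, hlip⟩ := exists_radialOp_lipschitz hν hγ hm K hR
  have key : ∀ j : ℕ, ∀ r ∈ Icc 0 R, |w r - v r| ≤ K * C ^ j / j.factorial * r ^ j := by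
    intro j
    induction j with
    | zero =>
      intro r hr
      have h1 := hwK r hr
      have h2 := hvK r hr
      rw [abs_le]
      simp only [pow_zero, Nat.factorial_zero, Nat.cast_one, mul_one, div_one]
      constructor <;> linarith [h1.1, h1.2, h2.1, h2.2]
    | succ j ih =>
      intro r hr
      rw [hwf r hr, hvf r hr]
      refine (hlip w v hw hv hwK hvK _ j (by positivity) ih r hr).trans (le_of_eq ?_)
      rw [Nat.factorial_succ]
      push_cast
      field_simp
      ring
  intro r hr
  have hlim : Tendsto (fun j : ℕ => K * ((C * r) ^ j / j.factorial)) atTop (𝓝 (K * 0)) :=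
    (FloorSemiring.tendsto_pow_div_factorial_atTop (C * r)).const_mul K
  rw [mul_zero] at hlim
  have h0 : |w r - v r| ≤ 0 := ge_of_tendsto' hlim fun j => (key j r hr).trans (le_of_eq (by
    rw [mul_pow]; ring))
  exact sub_eq_zero.1 (abs_nonpos_iff.1 h0)

/-- The fixed point is the limit of the Picard iterates of 0, written as a telescoping series
dominated by an exponential series on each bounded interval. -/
theorem exists_radialOp_fixedPoint (hν : 0 < ν) (hγ : 0 < γ) (hm : 0 ≤ m) :
    ∃ w : ℝ → ℝ, Continuous w ∧ radialOp ν γ m w = w := by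
  set W : ℕ → ℝ → ℝ := fun k => (radialOp ν γ m)^[k] (fun _ => 0)
  have hW0 : W 0 = fun _ => 0 := rfl
  have hWs : ∀ k, W (k + 1) = radialOp ν γ m (W k) := fun k =>
    Function.iterate_succ_apply' _ _ _
  have hWc : ∀ k, Continuous (W k) := by
    intro k
    induction k with
    | zero => exact continuous_const
    | succ k ih => rw [hWs]; exact continuous_radialOp hν hγ.le hm ih
  have hWle : ∀ k x, 0 ≤ x → W k x ≤ 0 := by
    intro k x hx
    cases k with
    | zero => exact le_rfl
    | succ k => rw [hWs]; exact radialOp_nonpos hν (hWc k) hx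
  have hWneg : ∀ k x, x ≤ 0 → W k x = 0 := by
    intro k x hx
    cases k with
    | zero => rfl
    | succ k => rw [hWs]; exact radialOp_of_nonpos hγ hx
  have hWK : ∀ R, 0 ≤ R → ∀ k, ∀ x ∈ Icc 0 R, W k x ∈ Icc (-(R ^ γ * (1 / ν) ^ m * R)) 0 := by
    intro R hR k x hx
    refine ⟨?_, hWle k x hx.1⟩
    cases k with
    | zero => exact neg_nonpos.2 (by positivity)
    | succ k =>
      rw [hWs]
      exact neg_le_radialOp hν hγ.le hm (hWc k) hx fun y hy => hWle k y hy.1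
  set w : ℝ → ℝ := fun x => ∑' k : ℕ, (W (k + 1) x - W k x)
  -- All iterates vanish on the negative axis, so convergence is uniform on all of `Iic R`, which is
  -- a neighbourhood of each point below `R`.
  have hunif : ∀ R, 0 ≤ R → TendstoUniformlyOn W w atTop (Iic R) := by
    intro R hR
    set K := R ^ γ * (1 / ν) ^ m * R
    have hK : 0 ≤ K := by positivity
    obtain ⟨C, hC, hlip⟩ := exists_radialOp_lipschitz hν hγ.le hm K hR
    have key : ∀ j : ℕ, ∀ r ∈ Icc 0 R, |W (j + 1) r - W j r|
        ≤ K * C ^ j / j.factorial * r ^ j := by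
      intro j
      induction j with
      | zero =>
        intro r hr
        have h1 := hWK R hR 1 r hr
        rw [hW0, zero_add, sub_zero, abs_of_nonpos h1.2]
        simp only [pow_zero, Nat.factorial_zero, Nat.cast_one, mul_one, div_one]
        linarith [h1.1]
      | succ j ih =>
        intro r hr
        rw [hWs (j + 1), hWs j]
        have hb := hlip _ _ (hWc (j + 1)) (hWc j) (hWK R hR _) (hWK R hR _) _ j
          (by positivity) ih r hr
        rw [hWs j] at hb
        refine hb.trans (le_of_eq ?_)
        rw [Nat.factorial_succ]
        push_cast
        field_simp
        ring
    have hsum : Summable fun j : ℕ => K * ((C * R) ^ j / j.factorial) :=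
      (Real.summable_pow_div_factorial _).mul_left K
    have hT := tendstoUniformlyOn_tsum_nat (f := fun k x => W (k + 1) x - W k x) hsum
      (s := Iic R) fun j x hx => by
        rw [Real.norm_eq_abs]
        rcases le_total x 0 with hx0 | hx0
        · rw [hWneg _ _ hx0, hWneg _ _ hx0, sub_zero, abs_zero]; positivity
        · refine (key j x ⟨hx0, hx⟩).trans ?_
          have : x ^ j ≤ R ^ j := pow_le_pow_left₀ hx0 hx j
          calc _ ≤ K * C ^ j / j.factorial * R ^ j := by gcongr
            _ = _ := by rw [mul_pow]; ring
    refine hT.congr (Eventually.of_forall fun k x _ => ?_)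
    simp only
    rw [Finset.sum_range_sub (fun i => W i x), hW0, sub_zero]
  have hwc : Continuous w := by
    refine continuous_iff_continuousAt.2 fun x => ?_
    have h := (hunif (|x| + 1) (by positivity)).continuousOn
      (Eventually.of_forall fun k => (hWc k).continuousOn).frequently
    exact h.continuousAt (Iic_mem_nhds (by linarith [le_abs_self x]))
  have hpt : ∀ x, Tendsto (fun k => W k x) atTop (𝓝 (w x)) := fun x =>
    (hunif |x| (abs_nonneg x)).tendsto_at (le_abs_self x)
  refine ⟨w, hwc, funext fun r => ?_⟩
  rcases le_total r 0 with hr | hr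
  · rw [radialOp_of_nonpos hγ hr]
    exact tendsto_nhds_unique (by simp [hWneg _ _ hr]) (hpt r)
  obtain ⟨C, hC, hlip⟩ := exists_radialOp_lipschitz hν hγ.le hm
    (r ^ γ * (1 / ν) ^ m * r) hr
  have hwK : ∀ x ∈ Icc 0 r, w x ∈ Icc (-(r ^ γ * (1 / ν) ^ m * r)) 0 := fun x hx =>
    isClosed_Icc.mem_of_tendsto (hpt x) (Eventually.of_forall fun k => hWK r hr k x hx)
  refine tendsto_nhds_unique ?_ ((tendsto_add_atTop_iff_nat 1).2 (hpt r))
  rw [Metric.tendsto_atTop]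
  intro ε hε
  -- The added 1 keeps the denominator positive when `C * r = 0`.
  have hC1 : 0 < C * r + 1 := by positivity
  have hev := Metric.tendstoUniformlyOn_iff.1 (hunif r hr) (ε / (C * r + 1)) (by positivity)
  obtain ⟨N, hN⟩ := eventually_atTop.1 hev
  refine ⟨N, fun k hk => ?_⟩
  have hd : ∀ x ∈ Icc 0 r, |W k x - w x| ≤ ε / (C * r + 1) * x ^ 0 := fun x hx => by
    have := (hN k hk x hx.2).le
    rwa [dist_comm, Real.dist_eq, ← mul_one (ε / (C * r + 1)), ← pow_zero x] at this
  have := hlip _ _ (hWc k) hwc (hWK r hr k) hwK _ 0 (by positivity) hd r ⟨hr, le_rfl⟩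
  rw [hWs, Real.dist_eq]
  refine this.trans_lt ?_
  have h2 : C * (ε / (C * r + 1)) * (r ^ (0 + 1) / ((0 : ℕ) + 1)) = ε * (C * r / (C * r + 1)) := by
    push_cast
    field_simp
    ring
  rw [h2]
  have : C * r / (C * r + 1) < 1 := (div_lt_one hC1).2 (by linarith)
  nlinarith

end Operator

/-! ### Barbalat's lemma. -/

section Barbalat

/-- By the mean value theorem `f` is small somewhere in each short interval far out, since `F`
hardly varies there; uniform continuity spreads this to the whole interval. -/
theorem tendsto_zero_of_uniformContinuousOn_deriv {f F : ℝ → ℝ} {l : ℝ}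
    (hF : ∀ t, 0 ≤ t → HasDerivAt F (f t) t) (hl : Tendsto F atTop (𝓝 l))
    (hf : UniformContinuousOn f (Ici 0)) : Tendsto f atTop (𝓝 0) := by
  rw [Metric.tendsto_atTop]
  intro ε hε
  obtain ⟨δ, hδ, hunif⟩ := Metric.uniformContinuousOn_iff.1 hf (ε / 2) (by positivity)
  -- Two values of `F` beyond `T` differ by less than `(ε/2)(δ/2)`, so a mean slope over length
  -- `δ/2` is below `ε/2`.
  obtain ⟨T, hT⟩ := Metric.tendsto_atTop.1 hl (ε * (δ / 2) / 4) (by positivity)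
  refine ⟨max T 0, fun t ht => ?_⟩
  have ht0 : 0 ≤ t := (le_max_right _ _).trans ht
  have htT : T ≤ t := (le_max_left _ _).trans ht
  obtain ⟨c, hc, hcs⟩ := exists_hasDerivAt_eq_slope F f (show t < t + δ / 2 by linarith)
    (fun x hx => (hF x (ht0.trans hx.1)).continuousAt.continuousWithinAt)
    (fun x hx => hF x (ht0.trans hx.1.le))
  have h1 := hT t htT
  have h2 := hT (t + δ / 2) (by linarith)
  have h3 := hunif t ht0 c (ht0.trans hc.1.le) (by
    rw [Real.dist_eq, abs_lt]; constructor <;> linarith [hc.1, hc.2])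
  rw [Real.dist_eq, abs_lt] at h1 h2 h3
  have h4 : f c * (δ / 2) = F (t + δ / 2) - F t := by
    rw [hcs, add_sub_cancel_left]; field_simp
  have h5 : -(ε / 2) < f c := by nlinarith
  have h6 : f c < ε / 2 := by nlinarith
  rw [Real.dist_eq, sub_zero, abs_lt]
  constructor <;> linarith [h3.1, h3.2]

theorem uniformContinuousOn_comp_of_bounded_deriv {Y Q Y' Q' : ℝ → ℝ} {a b B : ℝ}
    (hY : ∀ t, 0 ≤ t → HasDerivAt Y (Y' t) t) (hQ : ∀ t, 0 ≤ t → HasDerivAt Q (Q' t) t)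
    (hY' : ∀ t, 0 ≤ t → |Y' t| ≤ B) (hQ' : ∀ t, 0 ≤ t → |Q' t| ≤ B)
    (hYb : ∀ t, 0 ≤ t → Y t ∈ Icc a b) (hQb : ∀ t, 0 ≤ t → Q t ∈ Icc a b)
    {G : ℝ × ℝ → ℝ} (hG : Continuous G) :
    UniformContinuousOn (fun t => G (Y t, Q t)) (Ici 0) := by
  have lip : ∀ f f' : ℝ → ℝ, (∀ t, 0 ≤ t → HasDerivAt f (f' t) t) → (∀ t, 0 ≤ t → |f' t| ≤ B) →
      UniformContinuousOn f (Ici 0) := fun f f' hf hb =>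
    (Convex.lipschitzOnWith_of_nnnorm_hasDerivWithin_le (C := B.toNNReal) (convex_Ici 0)
      (fun t ht => (hf t ht).hasDerivWithinAt) (fun t ht => by
        rw [← NNReal.coe_le_coe, coe_nnnorm, Real.norm_eq_abs]
        exact (hb t ht).trans (Real.le_coe_toNNReal B))).uniformContinuousOn
  have hpair : UniformContinuousOn (fun t => (Y t, Q t)) (Ici 0) := by
    have h1 := uniformContinuousOn_iff_restrict.1 (lip Y Y' hY hY')
    have h2 := uniformContinuousOn_iff_restrict.1 (lip Q Q' hQ hQ')
    exact uniformContinuousOn_iff_restrict.2 (h1.prodMk h2)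
  have hK : UniformContinuousOn G (Icc a b ×ˢ Icc a b) :=
    (isCompact_Icc.prod isCompact_Icc).uniformContinuousOn_of_continuous hG.continuousOn
  exact hK.comp hpair fun t ht => ⟨hYb t ht, hQb t ht⟩

end Barbalat

/-! ### The planar system, its Lyapunov function and convergence to equilibrium. -/

/-- Positive trajectories of the autonomous planar system that the radial equation becomes in the
variable `log r`, normalised so that the equilibrium is `(0, 1)`. -/
structure IsTrajectory (m β N : ℝ) (Y Q : ℝ → ℝ) : Prop where
  hasDerivAt_fst : ∀ t, HasDerivAt Y (β * (1 - Q t ^ m)) t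
  hasDerivAt_snd : ∀ t, HasDerivAt Q (N * (Real.exp (Y t) - Q t)) t
  pos : ∀ t, 0 < Q t

/-- A Lyapunov function of the planar system. -/
noncomputable def lyapunov (m β N y q : ℝ) : ℝ :=
  N * (Real.exp y - y - 1) + β * ((q ^ (m + 1) - 1) / (m + 1) - (q - 1))

section Lyapunov

variable {m β N : ℝ}

theorem lyapunov_snd_nonneg (hm : 0 < m) {q : ℝ} (hq : 0 ≤ q) :
    0 ≤ (q ^ (m + 1) - 1) / (m + 1) - (q - 1) := by
  have h := one_add_mul_self_le_rpow_one_add (show -1 ≤ q - 1 by linarith)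
    (show 1 ≤ m + 1 by linarith)
  rw [add_sub_cancel] at h
  rw [sub_nonneg, le_div_iff₀ (by positivity)]
  linarith

theorem abs_le_of_lyapunov_fst_le {y c : ℝ} (h : Real.exp y - y - 1 ≤ c) : |y| ≤ c + 1 := by
  rw [abs_le]
  have h0 := Real.exp_pos y
  refine ⟨by linarith, ?_⟩
  rcases le_total y 0 with hy | hy
  · linarith [Real.add_one_le_exp y]
  · have := Real.quadratic_le_exp_of_nonneg hy
    nlinarith [sq_nonneg (y - 2)]

/-- Beyond `(2(m+1))^(1/m)` one has `q^(m+1)/(m+1) ≥ 2q`, so the Lyapunov term is at least `q`. -/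
theorem le_of_lyapunov_snd_le (hm : 0 < m) {q c : ℝ} (hq : 0 < q) (hc : 0 ≤ c)
    (h : (q ^ (m + 1) - 1) / (m + 1) - (q - 1) ≤ c) : q ≤ c + (2 * (m + 1)) ^ (1 / m) := by
  by_contra! hlt
  have h1 : (2 * (m + 1)) ^ (1 / m) ≤ q := by linarith
  have h2 : 2 * (m + 1) ≤ q ^ m := by
    have := Real.rpow_le_rpow (by positivity) h1 hm.le
    rwa [← Real.rpow_mul (by positivity), one_div_mul_cancel hm.ne', Real.rpow_one] at this
  have h3 : q ^ (m + 1) = q ^ m * q := by rw [Real.rpow_add hq, Real.rpow_one]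
  have h5 : 1 / (m + 1) ≤ 1 := (div_le_one (by positivity)).2 (by linarith)
  have h6 : 1 ≤ (2 * (m + 1)) ^ (1 / m) := Real.one_le_rpow (by linarith) (by positivity)
  have h4 : 2 * q ≤ q ^ (m + 1) / (m + 1) := by
    rw [le_div_iff₀ (by positivity), h3]; nlinarith
  rw [sub_div] at h
  linarith

/-- The terms containing `e^Y` cancel. What remains is nonpositive because `q^m - 1` and `q - 1`
have the same sign. -/
theorem IsTrajectory.hasDerivAt_lyapunov {Y Q : ℝ → ℝ} (h : IsTrajectory m β N Y Q)
    (hm : 0 < m) (t : ℝ) :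
    HasDerivAt (fun t => lyapunov m β N (Y t) (Q t))
      (-(N * β * ((Q t ^ m - 1) * (Q t - 1)))) t := by
  have h1 := h.hasDerivAt_fst t
  have h2 := h.hasDerivAt_snd t
  have h3 := h2.rpow_const (p := m + 1) (Or.inl (h.pos t).ne')
  have h4 := (((h1.exp.sub h1).sub_const 1).const_mul N).add
    ((((h3.sub_const 1).div_const (m + 1)).sub (h2.sub_const 1)).const_mul β)
  refine h4.congr_deriv ?_
  rw [add_sub_cancel_right]
  field_simp
  ring

theorem rpow_sub_one_mul_nonneg (hm : 0 < m) {q : ℝ} (hq : 0 ≤ q) :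
    0 ≤ (q ^ m - 1) * (q - 1) := by
  rcases le_total q 1 with h | h
  · exact mul_nonneg_of_nonpos_of_nonpos (sub_nonpos.2 (Real.rpow_le_one hq h hm.le))
      (sub_nonpos.2 h)
  · exact mul_nonneg (sub_nonneg.2 (Real.one_le_rpow h hm.le)) (sub_nonneg.2 h)

theorem tendsto_one_of_rpow_sub_one_mul (hm : 0 < m) {Q : ℝ → ℝ} (hQ : ∀ t, 0 < Q t)
    (h : Tendsto (fun t => (Q t ^ m - 1) * (Q t - 1)) atTop (𝓝 0)) :
    Tendsto Q atTop (𝓝 1) := by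
  rw [Metric.tendsto_nhds]
  intro ε' hε'
  obtain ⟨ε, hε, hε1, hεle⟩ : ∃ ε : ℝ, 0 < ε ∧ ε < 1 ∧ ε ≤ ε' :=
    ⟨min ε' (1 / 2), by positivity, (min_le_right _ _).trans_lt (by norm_num), min_le_left _ _⟩
  have hd1 : 0 < ((1 + ε) ^ m - 1) * ε :=
    mul_pos (sub_pos.2 (Real.one_lt_rpow (by linarith) hm)) hε
  have hd2 : 0 < (1 - (1 - ε) ^ m) * ε :=
    mul_pos (sub_pos.2 (Real.rpow_lt_one (by linarith) (by linarith) hm)) hε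
  filter_upwards [h.eventually_lt_const hd1, h.eventually_lt_const hd2] with t h1 h2
  refine lt_of_lt_of_le ?_ hεle
  rw [Real.dist_eq, abs_lt]
  constructor
  · by_contra! hle
    have h3 : Q t ^ m ≤ (1 - ε) ^ m := Real.rpow_le_rpow (hQ t).le (by linarith) hm.le
    have h4 : (1 - ε) ^ m < 1 := Real.rpow_lt_one (by linarith) (by linarith) hm
    nlinarith
  · by_contra! hle
    have h3 : (1 + ε) ^ m ≤ Q t ^ m := Real.rpow_le_rpow (by linarith) (by linarith) hm.le
    have h4 : 1 < (1 + ε) ^ m := Real.one_lt_rpow (by linarith) hm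
    nlinarith

theorem IsTrajectory.exists_bound {Y Q : ℝ → ℝ} (h : IsTrajectory m β N Y Q) (hm : 0 < m)
    (hβ : 0 < β) (hN : 0 < N) :
    ∃ b, ∀ t, 0 ≤ t → Y t ∈ Icc (-b) b ∧ Q t ∈ Icc (-b) b := by
  have hanti : Antitone fun t => lyapunov m β N (Y t) (Q t) :=
    antitone_of_hasDerivAt_nonpos (h.hasDerivAt_lyapunov hm) fun t => neg_nonpos.2
      (mul_nonneg (by positivity) (rpow_sub_one_mul_nonneg hm (h.pos t).le))
  set c := lyapunov m β N (Y 0) (Q 0) with hc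
  refine ⟨max (c / N + 1) (c / β + (2 * (m + 1)) ^ (1 / m)), fun t ht => ?_⟩
  have h1 : lyapunov m β N (Y t) (Q t) ≤ c := hanti ht
  have h2 := lyapunov_snd_nonneg hm (h.pos t).le
  have h3 : 0 ≤ Real.exp (Y t) - Y t - 1 := by linarith [Real.add_one_le_exp (Y t)]
  rw [lyapunov] at h1
  have h4 : Real.exp (Y t) - Y t - 1 ≤ c / N := by
    rw [le_div_iff₀ hN]; nlinarith [mul_nonneg hβ.le h2]
  have h5 : (Q t ^ (m + 1) - 1) / (m + 1) - (Q t - 1) ≤ c / β := by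
    rw [le_div_iff₀ hβ]; nlinarith [mul_nonneg hN.le h3]
  have h6 := (abs_le_of_lyapunov_fst_le h4).trans
    (le_max_left _ (c / β + (2 * (m + 1)) ^ (1 / m)))
  have h7 := (le_of_lyapunov_snd_le hm (h.pos t) (h2.trans h5) h5).trans
    (le_max_right (c / N + 1) _)
  exact ⟨abs_le.1 h6, by linarith [h.pos t], h7⟩

/-- The dissipation vanishes only on the line `q = 1`, so Barbalat's lemma is used twice: on the
Lyapunov function, giving `Q → 1`, and then on `Q` itself, giving `Q' → 0` and hence `e^Y → 1`. -/
theorem IsTrajectory.tendsto {Y Q : ℝ → ℝ} (h : IsTrajectory m β N Y Q) (hm : 0 < m)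
    (hβ : 0 < β) (hN : 0 < N) : Tendsto Y atTop (𝓝 0) ∧ Tendsto Q atTop (𝓝 1) := by
  obtain ⟨b, hb⟩ := h.exists_bound hm hβ hN
  have hrc := Real.continuous_rpow_const hm.le
  set G₁ : ℝ × ℝ → ℝ := fun z => β * (1 - z.2 ^ m) with hG₁
  set G₂ : ℝ × ℝ → ℝ := fun z => N * (Real.exp z.1 - z.2) with hG₂
  set G₃ : ℝ × ℝ → ℝ := fun z => -(N * β * ((z.2 ^ m - 1) * (z.2 - 1))) with hG₃
  have hc₁ : Continuous G₁ := by fun_prop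
  have hc₂ : Continuous G₂ := by fun_prop
  have hc₃ : Continuous G₃ := by fun_prop
  have hcomp : IsCompact (Icc (-b) b ×ˢ Icc (-b) b) := isCompact_Icc.prod isCompact_Icc
  obtain ⟨B₁, hB₁⟩ := hcomp.exists_bound_of_continuousOn hc₁.continuousOn
  obtain ⟨B₂, hB₂⟩ := hcomp.exists_bound_of_continuousOn hc₂.continuousOn
  have unif : ∀ G : ℝ × ℝ → ℝ, Continuous G →
      UniformContinuousOn (fun t => G (Y t, Q t)) (Ici 0) := fun G hG =>
    uniformContinuousOn_comp_of_bounded_deriv (B := max B₁ B₂)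
      (fun t _ => h.hasDerivAt_fst t) (fun t _ => h.hasDerivAt_snd t)
      (fun t ht => (hB₁ (Y t, Q t) (hb t ht)).trans (le_max_left _ _))
      (fun t ht => (hB₂ (Y t, Q t) (hb t ht)).trans (le_max_right _ _))
      (fun t ht => (hb t ht).1) (fun t ht => (hb t ht).2) hG
  have hanti : Antitone fun t => lyapunov m β N (Y t) (Q t) :=
    antitone_of_hasDerivAt_nonpos (h.hasDerivAt_lyapunov hm) fun t => neg_nonpos.2
      (mul_nonneg (by positivity) (rpow_sub_one_mul_nonneg hm (h.pos t).le))
  have hVl : ∃ l, Tendsto (fun t => lyapunov m β N (Y t) (Q t)) atTop (𝓝 l) := by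
    refine ⟨_, tendsto_atTop_ciInf hanti ⟨0, ?_⟩⟩
    rintro _ ⟨t, rfl⟩
    have h2 := lyapunov_snd_nonneg hm (h.pos t).le
    have h3 : 0 ≤ Real.exp (Y t) - Y t - 1 := by linarith [Real.add_one_le_exp (Y t)]
    exact add_nonneg (mul_nonneg hN.le h3) (mul_nonneg hβ.le h2)
  obtain ⟨l, hl⟩ := hVl
  have hQ : Tendsto Q atTop (𝓝 1) := by
    have h1 := tendsto_zero_of_uniformContinuousOn_deriv
      (fun t _ => h.hasDerivAt_lyapunov hm t) hl (unif G₃ hc₃)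
    refine tendsto_one_of_rpow_sub_one_mul hm h.pos ?_
    have h2 := h1.const_mul (-(N * β)⁻¹)
    rw [mul_zero] at h2
    refine h2.congr fun t => ?_
    field_simp
  refine ⟨?_, hQ⟩
  have h1 := tendsto_zero_of_uniformContinuousOn_deriv (fun t _ => h.hasDerivAt_snd t) hQ
    (unif G₂ hc₂)
  have h2 : Tendsto (fun t => Real.exp (Y t)) atTop (𝓝 1) := by
    have h3 := (h1.const_mul N⁻¹).add hQ
    rw [mul_zero, zero_add] at h3
    refine h3.congr fun t => ?_
    field_simp
    ring
  have h4 := (Real.continuousAt_log one_ne_zero).tendsto.comp h2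
  rw [Real.log_one] at h4
  exact h4.congr fun t => Real.log_exp _

end Lyapunov

/-! ### Spiralling around the equilibrium. -/

section Oscillation

variable {m β N : ℝ}

/-- A one-sided substitute for `y(e^y - 1) ≈ y²` near 0 that needs no division by `y`. -/
theorem sq_div_le_mul_exp_sub_one (y : ℝ) :
    y ^ 2 / (1 + |y|) ≤ y * (Real.exp y - 1) := by
  rw [div_le_iff₀ (by positivity)]
  rcases le_total 0 y with hy | hy
  · rw [abs_of_nonneg hy]
    have h1 := Real.add_one_le_exp y
    nlinarith [mul_nonneg hy (sub_nonneg.2 h1),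
      mul_nonneg (mul_nonneg hy hy) (sub_nonneg.2 h1)]
  · rw [abs_of_nonpos hy]
    have h1 := Real.add_one_le_exp (-y)
    have h2 : Real.exp y * Real.exp (-y) = 1 := by rw [← Real.exp_add]; simp
    have h3 : Real.exp y * (1 - y) ≤ 1 := by nlinarith [Real.exp_pos y]
    nlinarith

theorem tendsto_atBot_of_deriv_le {f f' : ℝ → ℝ} {T δ : ℝ} (hδ : 0 < δ)
    (hf : ∀ t, T ≤ t → HasDerivAt f (f' t) t) (hf' : ∀ t, T ≤ t → f' t ≤ -δ) :
    Tendsto f atTop atBot := by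
  have hanti : AntitoneOn (fun t => f t + δ * t) (Ici T) := by
    have hd : ∀ t, T ≤ t → HasDerivAt (fun t => f t + δ * t) (f' t + δ * 1) t := fun t ht =>
      (hf t ht).add ((hasDerivAt_id t).const_mul δ)
    refine antitoneOn_of_deriv_nonpos (convex_Ici T)
      (fun t ht => (hd t ht).continuousAt.continuousWithinAt) (fun t ht => ?_) fun t ht => ?_
    · exact (hd t (interior_subset ht)).differentiableAt.differentiableWithinAt
    · rw [(hd t (interior_subset ht)).deriv]
      linarith [hf' t (interior_subset ht)]
  have hlin : Tendsto (fun t => f T + δ * T + (-δ) * t) atTop atBot :=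
    tendsto_atBot_add_const_left _ _ (tendsto_id.const_mul_atTop_of_neg (by linarith))
  refine tendsto_atBot_mono' _ ?_ hlin
  filter_upwards [eventually_ge_atTop T] with t ht
  have := hanti (mem_Ici.2 le_rfl) (mem_Ici.2 ht) ht
  simp only at this
  linarith

/-- The ratio `R = Y/(Q-1)` nearly satisfies the Riccati equation `R' = -βm + NR - NR²`, whose right
side is at most `-βm + N/4 < 0`. As long as `Q` avoids 1, `R` thus decreases at least linearly. -/
theorem IsTrajectory.tendsto_ratio {Y Q : ℝ → ℝ} (h : IsTrajectory m β N Y Q) (hm : 0 < m)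
    (hβ : 0 < β) (hN : 0 < N) (hspiral : N < 4 * β * m) {T : ℝ} (hT : ∀ t, T ≤ t → Q t ≠ 1) :
    Tendsto (fun t => Y t / (Q t - 1)) atTop atBot := by
  obtain ⟨hY, hQ⟩ := h.tendsto hm hβ hN
  have hA : Tendsto (fun t => (Q t ^ m - 1) / (Q t - 1)) atTop (𝓝 m) := by
    have h1 := (Real.hasDerivAt_rpow_const (x := 1) (p := m) (Or.inl one_ne_zero))
    rw [Real.one_rpow, mul_one, hasDerivAt_iff_tendsto_slope] at h1
    have h2 : Tendsto Q atTop (𝓝[≠] 1) := tendsto_nhdsWithin_iff.2 ⟨hQ, by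
      filter_upwards [eventually_ge_atTop T] with t ht using hT t ht⟩
    refine (h1.comp h2).congr fun t => ?_
    simp only [Function.comp, slope_def_field, Real.one_rpow]
  have hbound : Tendsto (fun t => -β * ((Q t ^ m - 1) / (Q t - 1)) + N * (1 + |Y t|) / 4) atTop
      (𝓝 (-β * m + N * (1 + |0|) / 4)) :=
    (hA.const_mul (-β)).add (((hY.abs.const_add 1).const_mul N).div_const 4)
  rw [abs_zero, add_zero, mul_one] at hbound
  have hδ : 0 < (β * m - N / 4) / 2 := by linarith
  obtain ⟨T₁, hT₁⟩ := eventually_atTop.1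
    (hbound.eventually_le_const (show -β * m + N / 4 < -((β * m - N / 4) / 2) by linarith))
  refine tendsto_atBot_of_deriv_le (T := max T T₁) hδ
    (f' := fun t => (β * (1 - Q t ^ m) * (Q t - 1) - Y t * (N * (Real.exp (Y t) - Q t))) /
      (Q t - 1) ^ 2) (fun t ht => ?_) fun t ht => ?_
  · exact (h.hasDerivAt_fst t).div ((h.hasDerivAt_snd t).sub_const 1)
      (sub_ne_zero.2 (hT t ((le_max_left _ _).trans ht)))
  · refine le_trans ?_ (hT₁ t ((le_max_right _ _).trans ht))
    have hP : Q t - 1 ≠ 0 := sub_ne_zero.2 (hT t ((le_max_left _ _).trans ht))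
    set P := Q t - 1 with hPdef
    have hQP : Q t = P + 1 := by rw [hPdef]; ring
    set R := Y t / P with hR
    have hYR : Y t = R * P := by rw [hR]; field_simp
    have h1 := sq_div_le_mul_exp_sub_one (Y t)
    have hb : (0 : ℝ) < 1 + |Y t| := by positivity
    have h2 : R ^ 2 / (1 + |Y t|) ≤ Y t * (Real.exp (Y t) - 1) / P ^ 2 := by
      rw [le_div_iff₀ (by positivity)]
      refine le_trans (le_of_eq ?_) h1
      rw [hR]; field_simp
    have h3 : (β * (1 - Q t ^ m) * P - Y t * (N * (Real.exp (Y t) - Q t))) / P ^ 2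
        = -β * ((Q t ^ m - 1) / P) + N * R - N * (Y t * (Real.exp (Y t) - 1) / P ^ 2) := by
      rw [hR]
      field_simp
      rw [hQP]
      ring
    -- Completing the square in `R`; the factor `1 + |Y|` tends to 1.
    have h4 : N * R - N * (R ^ 2 / (1 + |Y t|)) ≤ N * (1 + |Y t|) / 4 := by
      have h5 : R - R ^ 2 / (1 + |Y t|) ≤ (1 + |Y t|) / 4 := by
        rw [sub_le_iff_le_add, ← sub_le_iff_le_add', le_div_iff₀ hb]
        nlinarith [sq_nonneg (2 * R - (1 + |Y t|))]
      nlinarith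
    rw [h3]
    nlinarith

/-- Otherwise `Q - 1` keeps one sign and `Y` eventually has the opposite one. But then `Y` moves
monotonically away from 0, contradicting `Y → 0`. -/
theorem IsTrajectory.exists_eq_one {Y Q : ℝ → ℝ} (h : IsTrajectory m β N Y Q) (hm : 0 < m)
    (hβ : 0 < β) (hN : 0 < N) (hspiral : N < 4 * β * m) (T : ℝ) : ∃ t, T ≤ t ∧ Q t = 1 := by
  by_contra! hT
  obtain ⟨hY, hQ⟩ := h.tendsto hm hβ hN
  obtain ⟨T₁, hT₁⟩ := eventually_atTop.1
    ((h.tendsto_ratio hm hβ hN hspiral hT).eventually_lt_atBot 0)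
  set S := max T T₁ with hS
  have hYc : Continuous Y := continuous_iff_continuousAt.2 fun t =>
    (h.hasDerivAt_fst t).continuousAt
  have hQc : Continuous Q := continuous_iff_continuousAt.2 fun t =>
    (h.hasDerivAt_snd t).continuousAt
  have hST : ∀ t, S ≤ t → Q t ≠ 1 := fun t ht => hT t ((le_max_left _ _).trans ht)
  have hneg : ∀ t, S ≤ t → Y t / (Q t - 1) < 0 := fun t ht =>
    hT₁ t ((le_max_right _ _).trans ht)
  have hYdiff : ∀ s : Set ℝ, DifferentiableOn ℝ Y s := fun s t _ =>
    (h.hasDerivAt_fst t).differentiableAt.differentiableWithinAt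
  rcases (hST S le_rfl).lt_or_gt with hlt | hgt
  · have hlt' : ∀ t, S ≤ t → Q t < 1 := by
      intro t ht
      by_contra! hle
      obtain ⟨c, hc, hc1⟩ := intermediate_value_Icc ht hQc.continuousOn ⟨hlt.le, hle⟩
      exact hST c hc.1 hc1
    have hYS : 0 < Y S := by
      by_contra! hle
      exact (div_nonneg_of_nonpos hle (by linarith)).not_gt (hneg S le_rfl)
    have hmono : MonotoneOn Y (Ici S) :=
      monotoneOn_of_deriv_nonneg (convex_Ici S) hYc.continuousOn (hYdiff _) fun t ht => by
        rw [(h.hasDerivAt_fst t).deriv]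
        have := Real.rpow_le_one (h.pos t).le (hlt' t (interior_subset ht)).le hm.le
        exact mul_nonneg hβ.le (by linarith)
    have : Y S ≤ 0 := ge_of_tendsto hY (by
      filter_upwards [eventually_ge_atTop S] with t ht using hmono (mem_Ici.2 le_rfl) ht ht)
    linarith
  · have hgt' : ∀ t, S ≤ t → 1 < Q t := by
      intro t ht
      by_contra! hle
      obtain ⟨c, hc, hc1⟩ := intermediate_value_Icc' ht hQc.continuousOn ⟨hle, hgt.le⟩
      exact hST c hc.1 hc1
    have hYS : Y S < 0 := by
      by_contra! hle
      exact (div_nonneg hle (by linarith)).not_gt (hneg S le_rfl)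
    have hanti : AntitoneOn Y (Ici S) :=
      antitoneOn_of_deriv_nonpos (convex_Ici S) hYc.continuousOn (hYdiff _) fun t ht => by
        rw [(h.hasDerivAt_fst t).deriv]
        have := Real.one_le_rpow (hgt' t (interior_subset ht)).le hm.le
        exact mul_nonpos_of_nonneg_of_nonpos hβ.le (by linarith)
    have : 0 ≤ Y S := le_of_tendsto hY (by
      filter_upwards [eventually_ge_atTop S] with t ht using hanti (mem_Ici.2 le_rfl) ht ht)
    linarith

end Oscillation

/-! ### The equilibrium is not reached in finite time. -/

section Equilibrium

variable {m β N : ℝ}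

/-- The times spent at the equilibrium form a closed set, and an open one by local ODE uniqueness.
Only smoothness of the field near `(0,1)` enters, so the behaviour of `q^m` at 0 is irrelevant. -/
theorem IsTrajectory.eq_equilibrium {Y Q : ℝ → ℝ} (h : IsTrajectory m β N Y Q) {t₀ : ℝ}
    (hY : Y t₀ = 0) (hQ : Q t₀ = 1) (t : ℝ) : Y t = 0 ∧ Q t = 1 := by
  set z : ℝ → ℝ × ℝ := fun t => (Y t, Q t) with hz
  set F : ℝ × ℝ → ℝ × ℝ := fun x => (β * (1 - x.2 ^ m), N * (Real.exp x.1 - x.2)) with hF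
  have hzd : ∀ t, HasDerivAt z (F (z t)) t := fun t =>
    (h.hasDerivAt_fst t).prodMk (h.hasDerivAt_snd t)
  have hzc : Continuous z := continuous_iff_continuousAt.2 fun t => (hzd t).continuousAt
  have hFe : F (0, 1) = 0 := by simp [hF]
  have hFc : ContDiffAt ℝ 1 F (0, 1) := by
    refine ContDiffAt.prodMk (contDiffAt_const.mul (contDiffAt_const.sub ?_)) ?_
    · exact contDiffAt_snd.rpow_const_of_ne one_ne_zero
    · exact contDiffAt_const.mul (contDiffAt_fst.exp.sub contDiffAt_snd)
  obtain ⟨K, s, hs, hlip⟩ := hFc.exists_lipschitzOnWith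
  have hopen : IsOpen {t | z t = (0, 1)} := by
    rw [isOpen_iff_mem_nhds]
    intro t (ht : z t = (0, 1))
    have hev := ODE_solution_unique_of_eventually (v := fun _ => F) (s := fun _ => s)
      (f := z) (g := fun _ => ((0, 1) : ℝ × ℝ)) (t₀ := t)
      (Eventually.of_forall fun _ => hlip)
      ((hzc.continuousAt.eventually (by rw [ht]; exact hs)).mono
        fun τ hτ => ⟨hzd τ, hτ⟩)
      (Eventually.of_forall fun τ => ⟨by rw [hFe]; exact hasDerivAt_const _ _, mem_of_mem_nhds hs⟩)
      ht
    exact hev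
  have hclosed : IsClosed {t | z t = (0, 1)} := isClosed_eq hzc continuous_const
  have huniv := IsClopen.eq_univ ⟨hclosed, hopen⟩ ⟨t₀, by simp [hz, hY, hQ]⟩
  have := huniv.ge (mem_univ t)
  simpa [hz] using this

end Equilibrium

/-! ### Crossings of `Q = 1` are turns of `Y`. -/

section Turns

/-- `f` is strictly monotone on both sides of `t`, in opposite directions. -/
def ChangesMonotonicity (f : ℝ → ℝ) (t : ℝ) : Prop :=
  ∃ b c : ℝ, b < t ∧ t < c ∧
    ((StrictMonoOn f (Icc b t) ∧ StrictAntiOn f (Icc t c)) ∨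
     (StrictAntiOn f (Icc b t) ∧ StrictMonoOn f (Icc t c)))

variable {m β N : ℝ}

/-- At such a time `Q' = N(e^Y - 1) ≠ 0`, so `Q - 1` changes sign strictly, and with it `Y' = β(1 -
Q^m)`. -/
theorem IsTrajectory.changesMonotonicity {Y Q : ℝ → ℝ} (h : IsTrajectory m β N Y Q) (hm : 0 < m)
    (hβ : 0 < β) (hN : 0 < N) {t : ℝ} (hQ : Q t = 1) (hY : Y t ≠ 0) :
    ChangesMonotonicity Y t := by
  have hYc : Continuous Y := continuous_iff_continuousAt.2 fun t =>
    (h.hasDerivAt_fst t).continuousAt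
  have anti : ∀ b c, (∀ x ∈ Ioo b c, 1 < Q x) → StrictAntiOn Y (Icc b c) := fun b c hb =>
    strictAntiOn_of_deriv_neg (convex_Icc b c) hYc.continuousOn fun x hx => by
      rw [interior_Icc] at hx
      rw [(h.hasDerivAt_fst x).deriv]
      have := Real.one_lt_rpow (hb x hx) hm
      exact mul_neg_of_pos_of_neg hβ (by linarith)
  have mono : ∀ b c, (∀ x ∈ Ioo b c, Q x < 1) → StrictMonoOn Y (Icc b c) := fun b c hb =>
    strictMonoOn_of_deriv_pos (convex_Icc b c) hYc.continuousOn fun x hx => by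
      rw [interior_Icc] at hx
      rw [(h.hasDerivAt_fst x).deriv]
      have := Real.rpow_lt_one (h.pos x).le (hb x hx) hm
      exact mul_pos hβ (by linarith)
  have hd := (h.hasDerivAt_snd t).sub_const 1
  rw [hQ] at hd
  have ball : ∀ {P : ℝ → Prop}, (∀ᶠ x in 𝓝 t, P x) → ∃ ε > 0, ∀ x ∈ Ioo (t - ε) (t + ε), P x := by
    intro P hP
    obtain ⟨ε, hε, hb⟩ := Metric.eventually_nhds_iff.1 hP
    refine ⟨ε, hε, fun x hx => hb ?_⟩
    rw [Real.dist_eq, abs_lt]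
    constructor <;> linarith [hx.1, hx.2]
  rcases hY.lt_or_gt with hlt | hgt
  · have hneg : deriv (fun x => Q x - 1) t < 0 := by
      rw [hd.deriv]
      have : Real.exp (Y t) < 1 := Real.exp_lt_one_iff.2 hlt
      exact mul_neg_of_pos_of_neg hN (by linarith)
    obtain ⟨ε, hε, hs⟩ := ball (eventually_nhdsWithin_sign_eq_of_deriv_neg hneg (by simp [hQ]))
    refine ⟨t - ε, t + ε, by linarith, by linarith, Or.inr ⟨anti _ _ fun x hx => ?_,
      mono _ _ fun x hx => ?_⟩⟩
    · have := hs x ⟨hx.1, by linarith [hx.2]⟩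
      rw [sign_pos (sub_pos.2 hx.2), sign_eq_one_iff] at this
      linarith
    · have := hs x ⟨by linarith [hx.1], hx.2⟩
      rw [sign_neg (sub_neg.2 hx.1), sign_eq_neg_one_iff] at this
      linarith
  · have hpos : 0 < deriv (fun x => Q x - 1) t := by
      rw [hd.deriv]
      have : 1 < Real.exp (Y t) := Real.one_lt_exp_iff.2 hgt
      exact mul_pos hN (by linarith)
    obtain ⟨ε, hε, hs⟩ := ball (eventually_nhdsWithin_sign_eq_of_deriv_pos hpos (by simp [hQ]))
    refine ⟨t - ε, t + ε, by linarith, by linarith, Or.inl ⟨mono _ _ fun x hx => ?_,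
      anti _ _ fun x hx => ?_⟩⟩
    · have := hs x ⟨hx.1, by linarith [hx.2]⟩
      rw [sign_neg (sub_neg.2 hx.2), sign_eq_neg_one_iff] at this
      linarith
    · have := hs x ⟨by linarith [hx.1], hx.2⟩
      rw [sign_pos (sub_pos.2 hx.1), sign_eq_one_iff] at this
      linarith

end Turns

/-! ### The profile `w` and its trajectory in logarithmic radius. -/

section Profile

variable {ν γ m β N : ℝ} {w : ℝ → ℝ}

/-- The substitution `x = s^ν τ` moves `s` into the limit of integration, so that the fundamental
theorem of calculus applies although `w` is merely continuous. -/
theorem rpow_mul_expAvg (hν : 0 < ν) (w : ℝ → ℝ) {s : ℝ} (hs : 0 ≤ s) :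
    s ^ ν * expAvg ν w s = ∫ x in (0 : ℝ)..s ^ ν, Real.exp (w (x ^ (1 / ν))) := by
  have h := intervalIntegral.smul_integral_comp_mul_left (a := 0) (b := 1)
    (fun x : ℝ => Real.exp (w (x ^ (1 / ν)))) (s ^ ν)
  rw [mul_zero, mul_one, smul_eq_mul] at h
  rw [← h, expAvg]
  congr 1
  refine intervalIntegral.integral_congr fun τ hτ => ?_
  rw [uIcc_of_le zero_le_one] at hτ
  rw [Real.mul_rpow (Real.rpow_nonneg hs _) hτ.1, ← Real.rpow_mul hs, mul_one_div_cancel hν.ne',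
    Real.rpow_one]

theorem hasDerivAt_rpow_mul_expAvg (hν : 0 < ν) (hw : Continuous w) {s : ℝ} (hs : 0 < s) :
    HasDerivAt (fun s => s ^ ν * expAvg ν w s) (ν * s ^ (ν - 1) * Real.exp (w s)) s := by
  have hc : Continuous fun x : ℝ => Real.exp (w (x ^ (1 / ν))) := by
    have h : Continuous fun τ : ℝ => τ ^ (1 / ν) := Real.continuous_rpow_const (by positivity)
    fun_prop
  have h1 := (hc.integral_hasStrictDerivAt 0 (s ^ ν)).hasDerivAt
  have h2 := h1.comp s (Real.hasDerivAt_rpow_const (p := ν) (Or.inl hs.ne'))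
  rw [← Real.rpow_mul hs.le, mul_one_div_cancel hν.ne', Real.rpow_one] at h2
  refine (h2.congr_deriv (by ring)).congr_of_eventuallyEq ?_
  filter_upwards [eventually_gt_nhds hs] with x hx using rpow_mul_expAvg hν w hx.le

theorem hasDerivAt_of_fixedPoint (hν : 0 < ν) (hγ : 0 ≤ γ) (hm : 0 ≤ m) (hw : Continuous w)
    (hfix : radialOp ν γ m w = w) (r : ℝ) : HasDerivAt w (-radialSlope ν γ m w r) r := by
  have := hasDerivAt_radialOp hν hγ hm hw r
  rwa [hfix] at this

theorem fixedPoint_of_nonpos (hγ : 0 < γ) (hfix : radialOp ν γ m w = w) {r : ℝ} (hr : r ≤ 0) :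
    w r = 0 := by
  rw [← hfix, radialOp_of_nonpos hγ hr]

theorem contDiff_fixedPoint (hν : 0 < ν) (hγ : 0 ≤ γ) (hm : 0 ≤ m) (hw : Continuous w)
    (hfix : radialOp ν γ m w = w) : ContDiff ℝ 1 w := by
  have hd := hasDerivAt_of_fixedPoint hν hγ hm hw hfix
  rw [contDiff_one_iff_deriv]
  refine ⟨fun r => (hd r).differentiableAt, ?_⟩
  rw [funext fun r => (hd r).deriv]
  exact (continuous_radialSlope hν hγ hm hw).neg

theorem strictAntiOn_fixedPoint (hν : 0 < ν) (hγ : 0 ≤ γ) (hm : 0 ≤ m) (hw : Continuous w)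
    (hfix : radialOp ν γ m w = w) : StrictAntiOn w (Ici 0) :=
  strictAntiOn_of_deriv_neg (convex_Ici 0) hw.continuousOn fun r hr => by
    rw [interior_Ici] at hr
    rw [(hasDerivAt_of_fixedPoint hν hγ hm hw hfix r).deriv]
    exact neg_neg_of_pos (radialSlope_pos hν hw hr)

/-- In logarithmic radius, a fixed point of the radial operator gives a trajectory of the planar
system. -/
theorem isTrajectory_of_fixedPoint (hν : 0 < ν) (hγ : 0 ≤ γ) (hm : 0 < m) (hβ : 0 < β)
    (hN : 0 < N) (hβm : 1 + γ = β * m) (hNν : β + N = ν) (hw : Continuous w)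
    (hfix : radialOp ν γ m w = w) :
    IsTrajectory m β N
      (fun t => w (Real.exp t) + β * t - Real.log (N * β ^ (1 / m)))
      (fun t => Real.exp (β * t) * expAvg ν w (Real.exp t) / ν / β ^ (1 / m)) := by
  have hq0 : 0 < β ^ (1 / m) := by positivity
  have hqm : (β ^ (1 / m)) ^ m = β := by
    rw [← Real.rpow_mul hβ.le, one_div_mul_cancel hm.ne', Real.rpow_one]
  have havg := expAvg_pos hν hw
  refine ⟨fun t => ?_, fun t => ?_, fun t => ?_⟩
  · have h1 := (hasDerivAt_of_fixedPoint hν hγ hm.le hw hfix (Real.exp t)).comp t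
      (Real.hasDerivAt_exp t)
    have h2 := (h1.add ((hasDerivAt_id t).const_mul β)).sub_const (Real.log (N * β ^ (1 / m)))
    refine h2.congr_deriv ?_
    rw [radialSlope, max_eq_left (Real.exp_pos t).le, ← Real.exp_mul,
      Real.div_rpow (by have := havg (Real.exp t); positivity) hq0.le, hqm, mul_div_assoc,
      Real.mul_rpow (Real.exp_pos _).le (by have := havg (Real.exp t); positivity),
      ← Real.exp_mul]
    -- The relation `1 + γ = βm` makes `-r w'(r)` the `m`-th power of `r^β * expAvg ν w r / ν`,
    -- which closes the system.
    have h3 : Real.exp (t * γ) * Real.exp t = Real.exp (β * t * m) := by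
      rw [← Real.exp_add]
      congr 1
      linear_combination t * hβm
    rw [← h3]
    field_simp
    ring
  · have h1 := (hasDerivAt_rpow_mul_expAvg hν hw (Real.exp_pos t)).comp t (Real.hasDerivAt_exp t)
    have h2 := ((((hasDerivAt_id t).const_mul (-N)).exp.mul h1).div_const ν).div_const (β ^ (1 / m))
    -- Since `β = ν - N`, the factor `e^(νt)` can be grouped with the average, whose product has a
    -- known derivative; `e^(-Nt)` then contributes the term `-NQ`.
    have heq : (fun t => Real.exp (β * t) * expAvg ν w (Real.exp t) / ν / β ^ (1 / m)) =
        fun t => Real.exp (-N * t) * (Real.exp t ^ ν * expAvg ν w (Real.exp t)) / ν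
          / β ^ (1 / m) := by
      funext t
      rw [← mul_assoc, ← Real.exp_mul, ← Real.exp_add, ← hNν]
      ring_nf
    rw [heq]
    refine h2.congr_deriv ?_
    have h3 : Real.exp (w (Real.exp t) + β * t - Real.log (N * β ^ (1 / m)))
        = Real.exp (w (Real.exp t)) * Real.exp (β * t) / (N * β ^ (1 / m)) := by
      rw [Real.exp_sub, Real.exp_add, Real.exp_log (by positivity)]
    have h4 : Real.exp (-N * t) * (Real.exp t ^ (ν - 1) * Real.exp t) = Real.exp (β * t) := by
      rw [← Real.exp_mul, ← Real.exp_add, ← Real.exp_add]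
      congr 1
      linear_combination (-t) * hNν
    have h5 : Real.exp t ^ ν = Real.exp t ^ (ν - 1) * Real.exp t := by
      rw [← Real.rpow_add_one (Real.exp_pos t).ne', sub_add_cancel]
    rw [h3, ← h4]
    simp only [Function.comp, id]
    rw [h5]
    field_simp
    ring
  · have := havg (Real.exp t)
    positivity

theorem tendsto_fixedPoint_atBot (hν : 0 < ν) (hγ : 0 ≤ γ) (hm : 0 < m) (hβ : 0 < β)
    (hN : 0 < N) (hβm : 1 + γ = β * m) (hNν : β + N = ν) (hw : Continuous w)
    (hfix : radialOp ν γ m w = w) : Tendsto w atTop atBot := by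
  have h1 := ((isTrajectory_of_fixedPoint hν hγ hm hβ hN hβm hNν hw hfix).tendsto hm hβ hN).1
  have h2 : Tendsto (fun t => -β * t + Real.log (N * β ^ (1 / m))) atTop atBot :=
    tendsto_atBot_add_const_right _ _ (tendsto_id.const_mul_atTop_of_neg (by linarith))
  have h3 : Tendsto (fun t => w (Real.exp t)) atTop atBot :=
    (h1.add_atBot h2).congr fun t => by ring
  refine (h3.comp Real.tendsto_log_atTop).congr' ?_
  filter_upwards [eventually_gt_atTop 0] with r hr
  simp only [Function.comp, Real.exp_log hr]

/-- The inverse function of `-w` on the positive half-line. -/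
theorem exists_inverse_neg {w : ℝ → ℝ} (hw : Continuous w) (hw0 : ∀ r ≤ 0, w r = 0)
    (hanti : StrictAntiOn w (Ici 0)) (hlim : Tendsto w atTop atBot) :
    ∃ ρ : ℝ → ℝ, Continuous ρ ∧ StrictMono ρ ∧ Tendsto ρ atTop atTop ∧
      (∀ a, 0 < a → 0 < ρ a ∧ w (ρ a) = -a) ∧ ∀ r, 0 < r → ρ (-w r) = r := by
  -- Adding `min r 0` extends `-w` by the identity on the negative axis, giving an order isomorphism
  -- of the line; continuity of the inverse is then automatic.
  set H : ℝ → ℝ := fun r => min r 0 - w r with hH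
  have hHc : Continuous H := by fun_prop
  have hmono : StrictMono H := by
    intro a b hab
    simp only [hH]
    rcases lt_or_ge a 0 with ha | ha
    · rw [hw0 a ha.le, min_eq_left ha.le]
      rcases le_total b 0 with hb | hb
      · rw [hw0 b hb, min_eq_left hb]; linarith
      · have := hanti.antitoneOn (mem_Ici.2 le_rfl) hb hb
        rw [hw0 0 le_rfl] at this
        rw [min_eq_right hb]; linarith
    · have := hanti ha (mem_Ici.2 (ha.trans hab.le)) hab
      rw [min_eq_right ha, min_eq_right (ha.trans hab.le)]; linarith
  have hsurj : Function.Surjective H := by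
    refine hHc.surjective ?_ ?_
    · refine (tendsto_neg_atBot_atTop.comp hlim).congr' ?_
      filter_upwards [eventually_ge_atTop 0] with r hr
      simp [hH, min_eq_right hr]
    · refine tendsto_id.congr' ?_
      filter_upwards [eventually_le_atBot 0] with r hr
      simp [hH, min_eq_left hr, hw0 r hr]
  set e := hmono.orderIsoOfSurjective H hsurj with he
  have heH : ∀ r, e r = H r := fun _ => rfl
  have hH0 : H 0 = 0 := by simp [hH, hw0 0 le_rfl]
  refine ⟨e.symm, e.symm.continuous, e.symm.strictMono, e.symm.tendsto_atTop,
    fun a ha => ?_, fun r hr => ?_⟩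
  · have h1 : 0 < e.symm a := by
      rw [← e.lt_iff_lt, e.apply_symm_apply, heH, hH0]; exact ha
    refine ⟨h1, ?_⟩
    have h2 : H (e.symm a) = a := by rw [← heH, e.apply_symm_apply]
    simp only [hH, min_eq_right h1.le] at h2
    linarith
  · rw [OrderIso.symm_apply_eq, heH]
    simp [hH, min_eq_right hr.le]

end Profile

/-! ### The function `φ`. -/

section Phi

variable {p : ℝ}

theorem phi_neg_of_pos (p : ℝ) {x : ℝ} (hx : 0 < x) : phi p (-x) = -x ^ (p - 1) := by
  rw [phi, abs_neg, abs_of_pos hx, show p - 1 = 1 + (p - 2) by ring, Real.rpow_add hx,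
    Real.rpow_one]
  ring

theorem phi_nonneg_of_nonneg {x : ℝ} (hx : 0 ≤ x) : 0 ≤ phi p x :=
  mul_nonneg hx (Real.rpow_nonneg (abs_nonneg _) _)

theorem eq_of_phi_eq_neg (hp : 1 < p) {x c : ℝ} (hc : 0 < c) (h : phi p x = -c) :
    x = -c ^ (1 / (p - 1)) := by
  have hx : x < 0 := by
    by_contra! hx
    linarith [phi_nonneg_of_nonneg (p := p) hx]
  have h1 := phi_neg_of_pos p (neg_pos.2 hx)
  rw [neg_neg, h, neg_inj] at h1
  rw [h1, ← Real.rpow_mul (by linarith), mul_one_div_cancel (by linarith), Real.rpow_one, neg_neg]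

theorem abs_phi_le (p v : ℝ) : |phi p v| ≤ |v| ^ (p - 1) := by
  rcases eq_or_ne v 0 with rfl | hv
  · simp only [phi, zero_mul, abs_zero]
    exact Real.rpow_nonneg le_rfl _
  · have hv' : 0 < |v| := abs_pos.2 hv
    rw [phi, abs_mul, abs_of_nonneg (Real.rpow_nonneg hv'.le _),
      show p - 1 = 1 + (p - 2) by ring, Real.rpow_add hv', Real.rpow_one]

theorem tendsto_phi_zero (hp : 1 < p) : Tendsto (phi p) (𝓝 0) (𝓝 0) := by
  have h : Tendsto (fun v : ℝ => |v| ^ (p - 1)) (𝓝 0) (𝓝 0) := by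
    have := ((Real.continuous_rpow_const (q := p - 1) (by linarith)).comp continuous_abs).tendsto 0
    simpa [Function.comp_def, Real.zero_rpow (show p - 1 ≠ 0 by linarith)] using this
  exact squeeze_zero_norm (fun v => abs_phi_le p v) h

end Phi

/-! ### Solutions of the boundary value problem are rescalings of `w`. -/

section BoundaryValueProblem

variable {p n α : ℝ} {w : ℝ → ℝ}

theorem radialSlope_rpow (hp : 1 < p) (hν : 0 < n + α) (hw : Continuous w) {s : ℝ} (hs : 0 < s) :
    radialSlope (n + α) ((1 + α) / (p - 1)) (1 / (p - 1)) w s ^ (p - 1)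
      = s ^ (1 - n) * (s ^ (n + α) * expAvg (n + α) w s) / (n + α) := by
  have hp1 : p - 1 ≠ 0 := by linarith
  have h1 := expAvg_pos hν hw s
  rw [radialSlope, max_eq_left hs.le, Real.mul_rpow (by positivity) (by positivity),
    ← Real.rpow_mul hs.le, ← Real.rpow_mul (by positivity), div_mul_cancel₀ _ hp1,
    div_mul_cancel₀ _ hp1, Real.rpow_one, ← mul_assoc, ← Real.rpow_add hs]
  ring_nf

theorem solvesEquation_rescale (hp : 1 < p) (hα : -1 < α) (hpn : p < n) (hw : Continuous w)
    (hfix : radialOp (n + α) ((1 + α) / (p - 1)) (1 / (p - 1)) w = w) {ρ : ℝ} (hρ : 0 < ρ) (a : ℝ) :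
    SolvesEquation p n α (ρ ^ (p + α) * Real.exp (-a)) (fun r => a + w (ρ * r)) := by
  have hν : 0 < n + α := by linarith
  have hp1 : 0 < p - 1 := by linarith
  have hγ : 0 < (1 + α) / (p - 1) := div_pos (by linarith) hp1
  have hm : 0 < 1 / (p - 1) := by positivity
  set S := radialSlope (n + α) ((1 + α) / (p - 1)) (1 / (p - 1)) w with hS
  set G : ℝ → ℝ := fun x => x ^ (n + α) * expAvg (n + α) w x with hG
  have hlin : ∀ r : ℝ, HasDerivAt (fun r => ρ * r) ρ r := fun r => by
    simpa using (hasDerivAt_id r).const_mul ρ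
  have hd : ∀ r, HasDerivAt (fun r => a + w (ρ * r)) (-(ρ * S (ρ * r))) r := fun r =>
    (((hasDerivAt_of_fixedPoint hν hγ.le hm.le hw hfix (ρ * r)).comp r (hlin r)).const_add
      a).congr_deriv (by ring)
  -- Applying `φ` undoes the power `1/(p-1)`, so the flux is a power times an integral and can be
  -- differentiated without differentiating `w'`.
  have hphi : ∀ r, 0 < r → phi p (deriv (fun r => a + w (ρ * r)) r)
      = -(ρ ^ (p - 1) / (n + α)) * ((ρ * r) ^ (1 - n) * G (ρ * r)) := by
    intro r hr
    have hρr : 0 < ρ * r := mul_pos hρ hr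
    have hSp := radialSlope_pos (γ := (1 + α) / (p - 1)) (m := 1 / (p - 1)) hν hw hρr
    rw [(hd r).deriv, phi_neg_of_pos p (mul_pos hρ hSp), Real.mul_rpow hρ.le hSp.le,
      radialSlope_rpow hp hν hw hρr]
    ring
  intro r hr
  have hr0 := hr.1
  set x := ρ * r with hx
  have hx0 : 0 < x := mul_pos hρ hr.1
  have hGd : HasDerivAt G ((n + α) * x ^ (n + α - 1) * Real.exp (w x)) x :=
    hasDerivAt_rpow_mul_expAvg hν hw hx0
  have hprod := ((((Real.hasDerivAt_rpow_const (p := 1 - n) (Or.inl hx0.ne')).mul hGd).comp r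
    (hlin r)).const_mul (-(ρ ^ (p - 1) / (n + α)))).congr_of_eventuallyEq (f₁ := fun s =>
      phi p (deriv (fun r => a + w (ρ * r)) s)) (by
        filter_upwards [eventually_gt_nhds hr.1] with s hs using hphi s hs)
  refine ⟨(hd r).differentiableAt, hprod.differentiableAt, ?_⟩
  rw [hprod.deriv, hphi r hr.1, ← hx]
  have e1 : x ^ (1 - n) = x ^ (-n) * x := by
    rw [show 1 - n = -n + 1 by ring, Real.rpow_add hx0, Real.rpow_one]
  have e2 : x ^ (1 - n - 1) = x ^ (-n) := by ring_nf
  have e3 : x ^ (n + α - 1) * x = x ^ n * x ^ α := by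
    rw [← Real.rpow_add hx0, ← Real.rpow_add_one hx0.ne']; ring_nf
  have e4 : x ^ (-n) * x ^ n = 1 := by rw [← Real.rpow_add hx0]; simp
  have e5 : x ^ α = ρ ^ α * r ^ α := Real.mul_rpow hρ.le hr.1.le
  have e6 : ρ ^ (p + α) = ρ ^ (p - 1) * ρ * ρ ^ α := by
    rw [← Real.rpow_add_one hρ.ne', ← Real.rpow_add hρ]; ring_nf
  have e7 : (n - 1) / r * (ρ * r) = (n - 1) * ρ := by field_simp
  rw [Real.exp_add, e2, e1, e6]
  have e8 : Real.exp (-a) * Real.exp a = 1 := by rw [← Real.exp_add]; simp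
  have hnα : (n + α)⁻¹ * (n + α) = 1 := inv_mul_cancel₀ hν.ne'
  have main : -(ρ ^ (p - 1) / (n + α)) * (((1 - n) * x ^ (-n) * G x +
      x ^ (-n) * x * ((n + α) * x ^ (n + α - 1) * Real.exp (w x))) * ρ) =
      -(ρ ^ (p - 1) / (n + α)) * ρ * (1 - n) * x ^ (-n) * G x
        - ρ ^ (p - 1) * ρ * (ρ ^ α * r ^ α) * Real.exp (w x) := by
    have : x ^ (-n) * x * ((n + α) * x ^ (n + α - 1) * Real.exp (w x))
        = (n + α) * (ρ ^ α * r ^ α) * Real.exp (w x) := by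
      rw [← e5]
      linear_combination (x ^ (-n) * (n + α) * Real.exp (w x)) * e3
        + ((n + α) * x ^ α * Real.exp (w x)) * e4
    rw [this]
    field_simp
    ring
  rw [main, hx] at *
  linear_combination (-(ρ ^ (p - 1) / (n + α)) * (ρ * r) ^ (-n) * G (ρ * r)) * e7
    + (ρ ^ (p - 1) * ρ * ρ ^ α * r ^ α * Real.exp (w (ρ * r))) * e8

theorem isSolution_rescale (hp : 1 < p) (hα : -1 < α) (hpn : p < n) (hw : Continuous w)
    (hfix : radialOp (n + α) ((1 + α) / (p - 1)) (1 / (p - 1)) w = w) {ρ a : ℝ} (hρ : 0 < ρ)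
    (ha : w ρ = -a) :
    IsSolution p n α (ρ ^ (p + α) * Real.exp (-a)) (fun r => a + w (ρ * r)) := by
  have hν : 0 < n + α := by linarith
  have hp1 : 0 < p - 1 := by linarith
  have hγ : 0 < (1 + α) / (p - 1) := div_pos (by linarith) hp1
  have hm : 0 < 1 / (p - 1) := by positivity
  refine ⟨?_, solvesEquation_rescale hp hα hpn hw hfix hρ a, ?_, by simp [ha]⟩
  · exact (contDiff_const.add ((contDiff_fixedPoint hν hγ.le hm.le hw hfix).comp
      (contDiff_const.mul contDiff_id))).contDiffOn
  · have h1 := hasDerivAt_of_fixedPoint hν hγ.le hm.le hw hfix (ρ * 0)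
    have h2 : HasDerivAt (fun r => ρ * r) ρ (0 : ℝ) := by
      simpa using (hasDerivAt_id (0 : ℝ)).const_mul ρ
    have h3 := (h1.comp (0 : ℝ) h2).const_add a
    rw [radialSlope_of_nonpos hγ (by simp), neg_zero, zero_mul] at h3
    exact h3.hasDerivWithinAt.derivWithin (uniqueDiffOn_Icc zero_lt_one 0 (by simp))

theorem tendsto_phi_deriv (hp : 1 < p) {lam : ℝ} {u : ℝ → ℝ} (hu : IsSolution p n α lam u) :
    Tendsto (fun s => phi p (deriv u s)) (𝓝[>] 0) (𝓝 0) := by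
  refine (tendsto_phi_zero hp).comp ?_
  have h1 := hu.contDiffOn.continuousOn_derivWithin (uniqueDiffOn_Icc zero_lt_one) le_rfl 0
    (by simp)
  rw [ContinuousWithinAt, hu.deriv_zero] at h1
  have h2 : Tendsto (derivWithin u (Icc 0 1)) (𝓝[>] 0) (𝓝 0) :=
    h1.mono_left (by
      rw [← nhdsWithin_Ioo_eq_nhdsGT (zero_lt_one' ℝ)]
      exact nhdsWithin_mono _ Ioo_subset_Icc_self)
  refine h2.congr' ?_
  filter_upwards [Ioo_mem_nhdsGT (zero_lt_one' ℝ)] with s hs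
  exact derivWithin_of_mem_nhds (Icc_mem_nhds hs.1 hs.2)

/-- The first integral of the radial equation. -/
theorem deriv_eq_of_isSolution (hp : 1 < p) (hα : -1 < α) (hpn : p < n) {lam : ℝ}
    (hlam : 0 < lam) {u v : ℝ → ℝ} (hu : IsSolution p n α lam u) (hv : Continuous v)
    (huv : ∀ r ∈ Icc (0 : ℝ) 1, v r = u r) {r : ℝ} (hr : r ∈ Ioo (0 : ℝ) 1) :
    deriv u r = -(lam / (n + α) * r ^ (1 + α) * expAvg (n + α) v r) ^ (1 / (p - 1)) := by
  have hν : 0 < n + α := by linarith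
  set G : ℝ → ℝ := fun x => x ^ (n + α) * expAvg (n + α) v x with hG
  -- The equation times `s^(n-1)` says `f' = 0`; the condition `u'(0) = 0` forces the constant to be
  -- 0.
  set f : ℝ → ℝ := fun s => s ^ (n - 1) * phi p (deriv u s) + lam / (n + α) * G s with hf
  have hfd : ∀ s ∈ Ioo (0 : ℝ) 1, HasDerivAt f 0 s := by
    intro s hs
    obtain ⟨-, h2, h3⟩ := hu.equation s hs
    have hs0 := hs.1
    have h4 := ((Real.hasDerivAt_rpow_const (p := n - 1) (Or.inl hs0.ne')).mul h2.hasDerivAt).add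
      ((hasDerivAt_rpow_mul_expAvg hν hv hs0).const_mul (lam / (n + α)))
    refine h4.congr_deriv ?_
    rw [huv s (Ioo_subset_Icc_self hs)]
    have e1 : s ^ (n - 1 - 1) = s ^ (n - 1) / s := Real.rpow_sub_one hs0.ne' _
    have e2 : s ^ (n + α - 1) = s ^ (n - 1) * s ^ α := by rw [← Real.rpow_add hs0]; ring_nf
    rw [e1, e2]
    have e3 : lam / (n + α) * ((n + α) * (s ^ (n - 1) * s ^ α) * Real.exp (u s))
        = lam * (s ^ (n - 1) * s ^ α) * Real.exp (u s) := by field_simp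
    rw [e3]
    linear_combination s ^ (n - 1) * h3
  have hconst : ∀ s ∈ Ioo (0 : ℝ) 1, f s = f r := fun s hs =>
    isOpen_Ioo.is_const_of_deriv_eq_zero isPreconnected_Ioo
      (fun x hx => (hfd x hx).differentiableAt.differentiableWithinAt)
      (fun x hx => (hfd x hx).deriv) hs hr
  have hG0 : Tendsto G (𝓝[>] 0) (𝓝 0) := by
    have hc : Continuous G := (Real.continuous_rpow_const hν.le).mul (continuous_expAvg hν hv)
    have := hc.tendsto 0
    simp only [hG, Real.zero_rpow hν.ne', zero_mul] at this
    exact this.mono_left nhdsWithin_le_nhds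
  have hpow : Tendsto (fun s : ℝ => s ^ (n - 1)) (𝓝[>] 0) (𝓝 0) := by
    have := (Real.continuous_rpow_const (show 0 ≤ n - 1 by linarith)).tendsto 0
    rw [Real.zero_rpow (by linarith)] at this
    exact this.mono_left nhdsWithin_le_nhds
  have hf0 : Tendsto f (𝓝[>] 0) (𝓝 0) := by
    have := (hpow.mul (tendsto_phi_deriv hp hu)).add (hG0.const_mul (lam / (n + α)))
    simpa using this
  have hfr : f r = 0 := by
    refine tendsto_nhds_unique (tendsto_const_nhds.congr' ?_) hf0
    filter_upwards [Ioo_mem_nhdsGT (zero_lt_one' ℝ)] with s hs using (hconst s hs).symm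
  have hr0 := hr.1
  have havg := expAvg_pos hν hv r
  refine eq_of_phi_eq_neg hp (by positivity) ?_
  have e1 : r ^ (n + α) = r ^ (n - 1) * r ^ (1 + α) := by rw [← Real.rpow_add hr0]; ring_nf
  have hrn : r ^ (n - 1) ≠ 0 := (Real.rpow_pos_of_pos hr0 _).ne'
  simp only [hf, hG] at hfr
  rw [e1] at hfr
  have h5 : r ^ (n - 1) * (phi p (deriv u r) + lam / (n + α) * r ^ (1 + α) * expAvg (n + α) v r)
      = 0 := by rw [← hfr]; ring
  linarith [(mul_eq_zero.1 h5).resolve_left hrn]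

/-- With `ρ^(p+α) = lam * e^(u 0)`, the function `u(r/ρ) - u 0` satisfies the fixed-point equation
of `w` on `[0, ρ]`, and uniqueness identifies the two. -/
theorem eq_rescale_of_isSolution (hp : 1 < p) (hα : -1 < α) (hpn : p < n) (hw : Continuous w)
    (hfix : radialOp (n + α) ((1 + α) / (p - 1)) (1 / (p - 1)) w = w) {lam : ℝ} (hlam : 0 < lam)
    {u : ℝ → ℝ} (hu : IsSolution p n α lam u) :
    ∃ ρ, 0 < ρ ∧ lam = ρ ^ (p + α) * Real.exp (-u 0) ∧
      ∀ r ∈ Icc (0 : ℝ) 1, u r = u 0 + w (ρ * r) := by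
  have hν : 0 < n + α := by linarith
  have hp1 : 0 < p - 1 := by linarith
  have hγ : 0 < (1 + α) / (p - 1) := div_pos (by linarith) hp1
  have hm : 0 < 1 / (p - 1) := by positivity
  have hβ : 0 < p + α := by linarith
  set ρ := (lam * Real.exp (u 0)) ^ (1 / (p + α)) with hρdef
  have hρ : 0 < ρ := by positivity
  have hρβ : ρ ^ (p + α) = lam * Real.exp (u 0) := by
    rw [hρdef, ← Real.rpow_mul (by positivity), one_div_mul_cancel hβ.ne', Real.rpow_one]
  -- Clamping the argument to `[0,1]` gives a continuous function on the line, as the operator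
  -- lemmas require.
  set ext : ℝ → ℝ := fun x => u (max 0 (min 1 x)) with hext
  have hextc : Continuous ext := by
    refine hu.contDiffOn.continuousOn.comp_continuous (by fun_prop) fun x => ?_
    exact ⟨le_max_left _ _, max_le zero_le_one (min_le_left _ _)⟩
  have hexteq : ∀ r ∈ Icc (0 : ℝ) 1, ext r = u r := fun r hr => by
    simp only [hext, min_eq_right hr.2, max_eq_right hr.1]
  set v : ℝ → ℝ := fun r => ext (ρ⁻¹ * r) - u 0 with hv
  have hvc : Continuous v := by fun_prop
  have havg : ∀ r, expAvg (n + α) ext (ρ⁻¹ * r) = Real.exp (u 0) * expAvg (n + α) v r := by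
    intro r
    rw [expAvg, expAvg, ← intervalIntegral.integral_const_mul]
    refine intervalIntegral.integral_congr fun τ _ => ?_
    simp only [hv]
    rw [← Real.exp_add, mul_assoc, add_sub_cancel]
  have hv0 : v 0 = 0 := by simp [hv, hexteq 0 (by simp)]
  have hvd : ∀ r ∈ Ioo 0 ρ, HasDerivAt v
      (-radialSlope (n + α) ((1 + α) / (p - 1)) (1 / (p - 1)) v r) r := by
    intro r hr
    have hx : ρ⁻¹ * r ∈ Ioo (0 : ℝ) 1 := by
      have h0 : 0 < ρ⁻¹ := inv_pos.2 hρ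
      refine ⟨mul_pos h0 hr.1, ?_⟩
      rw [inv_mul_lt_iff₀ hρ, mul_one]; exact hr.2
    have h1 := (hu.equation _ hx).1.hasDerivAt
    rw [deriv_eq_of_isSolution hp hα hpn hlam hu hextc hexteq hx] at h1
    have h2 : HasDerivAt ext _ (ρ⁻¹ * r) := h1.congr_of_eventuallyEq (by
      filter_upwards [Ioo_mem_nhds hx.1 hx.2] with y hy using hexteq y (Ioo_subset_Icc_self hy))
    have h3 : HasDerivAt (fun r => ρ⁻¹ * r) ρ⁻¹ r := by
      simpa using (hasDerivAt_id r).const_mul ρ⁻¹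
    refine ((h2.comp r h3).sub_const (u 0)).congr_deriv ?_
    have hr0 := hr.1
    have havp := expAvg_pos hν hvc r
    rw [havg, radialSlope, max_eq_left hr0.le, neg_mul, neg_inj]
    have e1 : r ^ ((1 + α) / (p - 1)) = (r ^ (1 + α)) ^ (1 / (p - 1)) := by
      rw [← Real.rpow_mul hr0.le, mul_one_div]
    have e2 : ρ⁻¹ = (ρ⁻¹ ^ (p - 1)) ^ (1 / (p - 1)) := by
      rw [← Real.rpow_mul (by positivity), mul_one_div_cancel hp1.ne', Real.rpow_one]
    have e3 : ∀ X : ℝ, 0 ≤ X → X ^ (1 / (p - 1)) * ρ⁻¹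
        = (X * ρ⁻¹ ^ (p - 1)) ^ (1 / (p - 1)) := fun X hX => by
      rw [Real.mul_rpow hX (by positivity), ← e2]
    rw [e3 _ (by positivity), e1, ← Real.mul_rpow (by positivity) (by positivity),
      Real.mul_rpow (by positivity) hr0.le]
    congr 1
    have e4 : ρ⁻¹ ^ (1 + α) * ρ⁻¹ ^ (p - 1) * (lam * Real.exp (u 0)) = 1 := by
      rw [← hρβ, ← Real.rpow_add (by positivity), show 1 + α + (p - 1) = p + α by ring,
        ← Real.mul_rpow (by positivity) hρ.le, inv_mul_cancel₀ hρ.ne', Real.one_rpow]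
    linear_combination (r ^ (1 + α) * expAvg (n + α) v r / (n + α)) * e4
  have hvfix : ∀ r ∈ Icc 0 ρ, v r = radialOp (n + α) ((1 + α) / (p - 1)) (1 / (p - 1)) v r := by
    intro r hr
    set T := radialOp (n + α) ((1 + α) / (p - 1)) (1 / (p - 1)) v with hT
    have hT0 : T 0 = 0 := radialOp_of_nonpos hγ le_rfl
    have hTc : Continuous T := continuous_radialOp hν hγ.le hm.le hvc
    rcases hr.1.eq_or_lt with h0 | h0
    · rw [← h0, hv0, hT0]
    -- Both functions vanish at 0 and have the same derivative inside, so they agree.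
    obtain ⟨c, -, hcs⟩ := exists_hasDerivAt_eq_slope (fun r => v r - T r) (fun _ => 0) h0
      (hvc.sub hTc).continuousOn fun x hx =>
        ((hvd x ⟨hx.1, hx.2.trans_le hr.2⟩).sub
          (hasDerivAt_radialOp hν hγ.le hm.le hvc x)).congr_deriv (sub_self _)
    rw [eq_comm, div_eq_zero_iff, hv0, hT0] at hcs
    rcases hcs with h | h <;> linarith
  have hvw := radialOp_fixedPoint_unique hν hγ.le hm.le hvc hw hρ.le hvfix
    (fun r _ => by rw [hfix])
  refine ⟨ρ, hρ, ?_, fun r hr => ?_⟩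
  · rw [hρβ, mul_assoc, ← Real.exp_add, add_neg_cancel, Real.exp_zero, mul_one]
  · rw [← hvw (ρ * r) ⟨mul_nonneg hρ.le hr.1, mul_le_of_le_one_right hρ.le hr.2⟩]
    simp only [hv]
    rw [inv_mul_cancel_left₀ hρ.ne', hexteq r hr, add_sub_cancel]

theorem isSingularSolution_log (hp : 1 < p) (hα : -1 < α) :
    IsSingularSolution p n α ((n - p) * (p + α) ^ (p - 1))
      (fun r => -(p + α) * Real.log r) := by
  have hβ : 0 < p + α := by linarith
  refine ⟨?_, by simp, ?_⟩
  · have hd : ∀ r : ℝ, 0 < r →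
        HasDerivAt (fun r => -(p + α) * Real.log r) (-((p + α) / r)) r := fun r hr =>
      ((Real.hasDerivAt_log hr.ne').const_mul _).congr_deriv (by ring)
    have hphi : ∀ r : ℝ, 0 < r → phi p (deriv (fun r => -(p + α) * Real.log r) r)
        = -(p + α) ^ (p - 1) * r ^ (1 - p) := fun r hr => by
      rw [(hd r hr).deriv, phi_neg_of_pos p (by positivity), Real.div_rpow hβ.le hr.le,
        show 1 - p = -(p - 1) by ring, Real.rpow_neg hr.le]
      ring
    intro r hr
    have hr0 := hr.1
    have h1 := ((Real.hasDerivAt_rpow_const (p := 1 - p) (Or.inl hr0.ne')).const_mul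
      (-(p + α) ^ (p - 1))).congr_of_eventuallyEq (f₁ := fun s =>
        phi p (deriv (fun r => -(p + α) * Real.log r) s)) (by
          filter_upwards [eventually_gt_nhds hr0] with s hs using hphi s hs)
    refine ⟨(hd r hr0).differentiableAt, h1.differentiableAt, ?_⟩
    rw [h1.deriv, hphi r hr0]
    have e1 : Real.exp (-(p + α) * Real.log r) = r ^ (-(p + α)) := by
      rw [Real.rpow_def_of_pos hr0, mul_comm]
    have e2 : r ^ (1 - p - 1) = r ^ (-p) := by ring_nf
    have e3 : r ^ (1 - p) = r ^ (-p) * r := by rw [← Real.rpow_add_one hr0.ne']; ring_nf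
    have e4 : r ^ α * r ^ (-(p + α)) = r ^ (-p) := by rw [← Real.rpow_add hr0]; ring_nf
    have e5 : (n - 1) / r * r = n - 1 := div_mul_cancel₀ _ hr0.ne'
    simp only
    rw [e1, e2, e3]
    linear_combination ((n - p) * (p + α) ^ (p - 1)) * e4
      - ((p + α) ^ (p - 1) * r ^ (-p)) * e5
  · exact Real.tendsto_log_nhdsGT_zero.const_mul_atBot_of_neg (by linarith)

end BoundaryValueProblem

end Gelfand

/-! ### Assembly of the solution curve. -/

theorem theorem5p1 (p n α : ℝ) (hp : 1 < p) (hα : -1 < α)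
    (hpn : p < n) (hn : n < (p ^ 2 + 3 * p + 4 * α) / (p - 1)) :
    ∃ (Λ : ℝ → ℝ) (U : ℝ → ℝ → ℝ),
      Gelfand.IsSolutionCurve p n α Λ U ∧
      {a : ℝ | Gelfand.IsTurn Λ a}.Infinite ∧
      Tendsto Λ atTop (𝓝 ((n - p) * (p + α) ^ (p - 1))) ∧
      (∀ r ∈ Ioc (0 : ℝ) 1,
        Tendsto (fun a => U a r) atTop (𝓝 (-(p + α) * Real.log r))) ∧
      Gelfand.IsSingularSolution p n α ((n - p) * (p + α) ^ (p - 1))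
        (fun r => -(p + α) * Real.log r) := by
  open Gelfand in
  have hp1 : 0 < p - 1 := by linarith
  have hν : 0 < n + α := by linarith
  have hγ : 0 < (1 + α) / (p - 1) := div_pos (by linarith) hp1
  have hm : 0 < 1 / (p - 1) := by positivity
  have hβ : 0 < p + α := by linarith
  have hN : 0 < n - p := by linarith
  have hβm : 1 + (1 + α) / (p - 1) = (p + α) * (1 / (p - 1)) := by field_simp; ring
  have hNν : p + α + (n - p) = n + α := by ring
  -- The upper bound on `n`, cleared of its denominator, is the negative discriminant condition `N <
  -- 4βm`.
  have hspiral : n - p < 4 * (p + α) * (1 / (p - 1)) := by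
    rw [lt_div_iff₀ hp1] at hn
    rw [mul_one_div, lt_div_iff₀ hp1]
    nlinarith
  obtain ⟨w, hw, hfix⟩ := exists_radialOp_fixedPoint hν hγ hm.le
  have hanti := strictAntiOn_fixedPoint hν hγ.le hm.le hw hfix
  have hw0 : ∀ r ≤ 0, w r = 0 := fun r hr => fixedPoint_of_nonpos hγ hfix hr
  obtain ⟨ρ, hρc, hρm, hρt, hρ, hρinv⟩ := exists_inverse_neg hw hw0 hanti
    (tendsto_fixedPoint_atBot hν hγ.le hm hβ hN hβm hNν hw hfix)
  have htraj := isTrajectory_of_fixedPoint hν hγ.le hm hβ hN hβm hNν hw hfix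
  set y₀ := Real.log ((n - p) * (p + α) ^ (1 / (1 / (p - 1)))) with hy₀
  set Y : ℝ → ℝ := fun t => w (Real.exp t) + (p + α) * t - y₀ with hY
  set Q : ℝ → ℝ := fun t => Real.exp ((p + α) * t) * expAvg (n + α) w (Real.exp t) / (n + α) /
    (p + α) ^ (1 / (1 / (p - 1))) with hQ
  obtain ⟨hYlim, -⟩ := htraj.tendsto hm hβ hN
  set Λ : ℝ → ℝ := fun a => ρ a ^ (p + α) * Real.exp (-a) with hΛ
  -- Up to the increasing maps `a ↦ log ρ(a)` and `exp`, `Λ` is `Y`, so turns and limits transfer.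
  have hΛY : ∀ a, 0 < a → Λ a = Real.exp (Y (Real.log (ρ a)) + y₀) := fun a ha => by
    obtain ⟨h1, h2⟩ := hρ a ha
    simp only [hΛ, hY]
    rw [Real.exp_log h1, h2, sub_add_cancel, Real.exp_add, mul_comm, Real.rpow_def_of_pos h1,
      mul_comm (Real.log _)]
  have hlogρ : Tendsto (fun a => Real.log (ρ a)) atTop atTop := Real.tendsto_log_atTop.comp hρt
  have hey₀ : Real.exp y₀ = (n - p) * (p + α) ^ (p - 1) := by
    rw [hy₀, one_div_one_div, Real.exp_log (by positivity)]
  have hA0 : ∀ t, 0 < -w (Real.exp t) := fun t => by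
    have := hanti (mem_Ici.2 le_rfl) (mem_Ici.2 (Real.exp_pos t).le) (Real.exp_pos t)
    rw [hw0 0 le_rfl] at this
    linarith
  have hAm : StrictMono fun t => -w (Real.exp t) := fun s t hst =>
    neg_lt_neg (hanti (Real.exp_pos s).le (Real.exp_pos t).le (Real.exp_lt_exp.2 hst))
  have hlogA : ∀ t, Real.log (ρ (-w (Real.exp t))) = t := fun t => by
    rw [hρinv _ (Real.exp_pos t), Real.log_exp]
  have hlog_mono : ∀ a b, 0 < a → a < b → Real.log (ρ a) < Real.log (ρ b) := fun a b ha hab =>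
    Real.log_lt_log (hρ a ha).1 (hρm hab)
  refine ⟨Λ, fun a r => a + w (ρ a * r), ⟨?_, ?_, ?_, ?_, ?_, ?_⟩, ?_, ?_, ?_,
    isSingularSolution_log hp hα⟩
  · intro a ha
    have := (hρ a ha).1
    positivity
  · exact fun a ha => isSolution_rescale hp hα hpn hw hfix (hρ a ha).1 (hρ a ha).2
  · intro a _
    simp [hw0 0 le_rfl]
  · intro lam u hlam hu
    obtain ⟨σ, hσ, hlamσ, hur⟩ := eq_rescale_of_isSolution hp hα hpn hw hfix hlam hu
    have h1 := hur 1 (by simp)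
    rw [hu.boundary, mul_one] at h1
    have h2 : u 0 = -w σ := by linarith
    have h3 : ρ (u 0) = σ := by rw [h2, hρinv σ hσ]
    refine ⟨?_, ?_, fun r hr => ?_⟩
    · have := hanti (mem_Ici.2 le_rfl) (mem_Ici.2 hσ.le) hσ
      rw [hw0 0 le_rfl] at this
      linarith
    · simp only [hΛ, h3]; exact hlamσ
    · simp only [h3]; exact hur r hr
  · have hc : Continuous Λ := by
      have := Real.continuous_rpow_const hβ.le
      fun_prop
    exact hc.continuousOn
  · have hc : Continuous fun q : ℝ × ℝ => q.1 + w (ρ q.1 * q.2) := by fun_prop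
    exact hc.continuousOn
  · have hYne : ∀ t, Q t = 1 → Y t ≠ 0 := by
      intro t hQt hYt
      have heq := htraj.eq_equilibrium hYt hQt
      -- On a constant trajectory `w(e^t) = y₀ - βt` for all `t`; this time makes the right side
      -- equal `β > 0`, whereas `w < 0` on the positive axis.
      have h1 := (heq (y₀ / (p + α) - 1)).1
      have h2 := hA0 (y₀ / (p + α) - 1)
      have h3 : (p + α) * (y₀ / (p + α) - 1) = y₀ - (p + α) := by field_simp
      simp only [hY, h3] at h1
      linarith
    have hturn : ∀ t, Q t = 1 → IsTurn Λ (-w (Real.exp t)) := by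
      intro t hQt
      obtain ⟨b, c, hb, hc, h⟩ := htraj.changesMonotonicity hm hβ hN hQt (hYne t hQt)
      have hmem : ∀ s s' x, x ∈ Icc (-w (Real.exp s)) (-w (Real.exp s')) →
          0 < x ∧ Real.log (ρ x) ∈ Icc s s' := by
        intro s s' x hx
        have hx0 : 0 < x := (hA0 s).trans_le hx.1
        refine ⟨hx0, ?_, ?_⟩
        · rw [← hlogA s]
          exact Real.log_le_log (hρ _ (hA0 s)).1 (hρm.monotone hx.1)
        · rw [← hlogA s']
          exact Real.log_le_log (hρ _ hx0).1 (hρm.monotone hx.2)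
      have mono : ∀ s s', StrictMonoOn Y (Icc s s') →
          StrictMonoOn Λ (Icc (-w (Real.exp s)) (-w (Real.exp s'))) := by
        intro s s' hs x hx x' hx' hxx
        obtain ⟨hx0, hxm⟩ := hmem s s' x hx
        obtain ⟨hx0', hxm'⟩ := hmem s s' x' hx'
        rw [hΛY x hx0, hΛY x' hx0']
        exact Real.exp_lt_exp.2 (add_lt_add_left (hs hxm hxm' (hlog_mono x x' hx0 hxx)) _)
      have anti : ∀ s s', StrictAntiOn Y (Icc s s') →
          StrictAntiOn Λ (Icc (-w (Real.exp s)) (-w (Real.exp s'))) := by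
        intro s s' hs x hx x' hx' hxx
        obtain ⟨hx0, hxm⟩ := hmem s s' x hx
        obtain ⟨hx0', hxm'⟩ := hmem s s' x' hx'
        rw [hΛY x hx0, hΛY x' hx0']
        exact Real.exp_lt_exp.2 (add_lt_add_left (hs hxm hxm' (hlog_mono x x' hx0 hxx)) _)
      exact ⟨_, _, hA0 b, hAm hb, hAm hc, h.imp (fun h => ⟨mono _ _ h.1, anti _ _ h.2⟩)
        fun h => ⟨anti _ _ h.1, mono _ _ h.2⟩⟩
    refine infinite_of_forall_exists_gt fun a => ?_
    -- The margin 1 makes the turning value exceed `max a 1` strictly; the maximum with 1 keeps the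
    -- argument of `ρ` positive.
    obtain ⟨t, ht, hQt⟩ := htraj.exists_eq_one hm hβ hN hspiral (Real.log (ρ (max a 1)) + 1)
    refine ⟨_, hturn t hQt, (le_max_left a 1).trans_lt ?_⟩
    have h1 : 0 < max a 1 := lt_max_of_lt_right one_pos
    by_contra! hle
    have := Real.log_le_log (hρ _ (hA0 t)).1 (hρm.monotone hle)
    rw [hlogA] at this
    linarith
  · have h1 := ((hYlim.comp hlogρ).add_const y₀).rexp
    rw [zero_add, hey₀] at h1
    refine h1.congr' ?_
    filter_upwards [eventually_gt_atTop 0] with a ha using (hΛY a ha).symm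
  · intro r hr
    have h1 := hYlim.comp hlogρ
    have h2 := hYlim.comp (tendsto_atTop_add_const_right _ (Real.log r) hlogρ)
    -- As `a = -w(ρ)`, one has `U a r = Y(log ρ + log r) - Y(log ρ) - β log r`, and both values of
    -- `Y` tend to 0.
    have h3 := (h2.sub h1).add_const (-(p + α) * Real.log r)
    rw [sub_zero, zero_add] at h3
    refine h3.congr' ?_
    filter_upwards [eventually_gt_atTop 0] with a ha
    obtain ⟨h4, h5⟩ := hρ a ha
    simp only [Function.comp, hY]
    rw [Real.exp_add, Real.exp_log h4, Real.exp_log hr.1, h5]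
    ring
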